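/- Fix $n\ge 1$, let $f:\{\pm1\}^n\to\{\pm1\}$, and write $\log$ for $\log_2$. Probabilities and expectations are over uniform $x\in\{\pm1\}^n$. The size of a decision tree is its number of leaves, $\mathrm{error}_f(T)=\Pr[f(x)\ne T(x)]$, and $\mathrm{opt}_s$ is the least error of a decision tree of size (at most) $s$. For a leaf $\ell$ of depth $|\ell|$, $f_\ell$ is the subfunction of $f$ obtained by fixing the attributes queried on the path to $\ell$. For $g:\{\pm1\}^n\to\mathbb R$ let $\hat g(S)=\mathbb E[g(x)\prod_{i\in S}x_i]$ and $\mathrm{Inf}_i^{(\delta,d)}(g)=\sum_{S\ni i,\,|S|\le d}(1-\delta)^{|S|}\hat g(S)^2$. The algorithm $\textsc{BuildStabilizingDT}_f(t,\delta,\varepsilon)$ puts $d=\log(1/\varepsilon)/\delta$ and starts from the tree with one unlabelled leaf. While the tree has fewer than $t$ leaves, it finds for every leaf $\ell$ an attribute $i$ that maximizes $\mathrm{Inf}^{(\delta,d)}_i(f_\ell)$, gives $\ell$ the score $2^{-|\ell|}\,\mathrm{Inf}_i^{(\delta,d)}(f_\ell)$, and splits a leaf of highest score with a query to its attribute. Finally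 it labels each leaf $\ell$ with $\mathrm{sign}(\mathbb E[f_\ell])$ and outputs the tree. Ties are broken arbitrarily. Running time counts real arithmetic operations, comparisons, and elementary steps of handling sets, attributes and tree nodes. The influences are computed from the coefficients $\hat f_\ell(S)$, $|S|\le d$, each of which is obtained exactly at a stated charge. For $A\in\mathbb N$, the example charge for one coefficient is $\bigl(2^{|\ell|}(n+1)^{\lfloor d\rfloor+1}\bigr)^A$, and the query charge is $\bigl((|\ell|+1)(n+1)^{\lfloor d\rfloor+1}\bigr)^A$; so $A$ ranges over all polynomial charges in $2^{|\ell|},n^d$ and in $|\ell|,n^d$, respectively. **Theorem.** There are an absolute constant $C$ and a function $t_0(s,\varepsilon)$ of $s$ and $\varepsilon$ only, with $1\le t_0(s,\varepsilon)\le s^{\tilde O((\log s)^2/\varepsilon^2)}$, such that the following holds for all integers $s\ge2$, all $\varepsilon\in(0,\frac12)$, $\delta=\varepsilon/\log s$, all $n\ge1$, all $f:\{\pm1\}^n\to\{\pm1\}$, and every tie-breaking rule. 1. $\textsc{BuildStabilizingDT}_f(t_0(s,\varepsilon),\delta,\varepsilon)$ returns a tree $T$ of size $t_0(s,\varepsilon)$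 with $\mathrm{error}_f(T)\le C\cdot\mathrm{opt}_s+\varepsilon$ and, with the query charge, runs in time $(ns)^{\tilde O((\log s)^2/\varepsilon^2)}$. 2. There is a size parameter $1\le t\le t_0(s,\varepsilon)$ (which may depend on $f$ and the tie-breaking rule) for which $\textsc{BuildStabilizingDT}_f(t,\delta,\varepsilon)$ returns a tree $T$ of size $t$ with $\mathrm{error}_f(T)\le C\cdot\mathrm{opt}_s+\varepsilon$ and, even with the example charge, runs in time $(ns)^{\tilde O((\log s)^2/\varepsilon^2)}$. Here $\tilde O(X)$, with $X=(\log s)^2/\varepsilon^2$, stands for a bound $K\,X\,(\log X)^c$, where $c$ is an absolute constant and $K$ is an absolute constant in the size bound and depends only on $A$ in the time bounds. -/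

import Mathlib

noncomputable section

namespace StabDT

/-! ### Boolean functions and Fourier analysis on the cube -/

/-- The cube `{±1}ⁿ`; the two signs are the units of `ℤ`. -/
abbrev Cube (n : ℕ) : Type := Fin n → ℤˣ

/-- A `{±1}`-valued function, read as a real-valued one. -/
def toReal {n : ℕ} (f : Cube n → ℤˣ) : Cube n → ℝ := fun x => ((f x : ℤ) : ℝ)

/-- The expectation of `g` under the uniform distribution on the cube. -/
def expect {n : ℕ} (g : Cube n → ℝ) : ℝ := (∑ x, g x) / 2 ^ n

/-- The Fourier coefficient of `g` at `S`. -/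
def fourierCoeff {n : ℕ} (g : Cube n → ℝ) (S : Finset (Fin n)) : ℝ :=
  expect fun x => g x * ∏ i ∈ S, ((x i : ℤ) : ℝ)

/-- The sets of at most `d` attributes that contain `i`. -/
def setsAt {n : ℕ} (d : ℝ) (i : Fin n) : Finset (Finset (Fin n)) :=
  Finset.univ.filter fun S => i ∈ S ∧ (S.card : ℝ) ≤ d

/-- The `δ`-noisy `d`-wise influence of `i` on `g`. -/
def noisyInfluence {n : ℕ} (δ d : ℝ) (g : Cube n → ℝ) (i : Fin n) : ℝ :=
  ∑ S ∈ setsAt d i, (1 - δ) ^ S.card * fourierCoeff g S ^ 2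

/-! ### Decision trees -/

/-- Decision trees over `n` attributes with leaves labelled by `α`. At `node i lo hi` the attribute
`i` is queried; the answer `-1` leads to `lo` and the answer `1` to `hi`. -/
inductive DTree (n : ℕ) (α : Type) : Type
  | leaf (a : α) : DTree n α
  | node (i : Fin n) (lo hi : DTree n α) : DTree n α

/-- A partial tree: a decision tree with unlabelled leaves. -/
abbrev PTree (n : ℕ) : Type := DTree n Unit

/-- The size of a tree: its number of leaves. -/
def DTree.size {n : ℕ} {α : Type} : DTree n α → ℕ
  | .leaf _ => 1
  | .node _ lo hi => lo.size + hi.size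

/-- The function on the cube that a tree represents. -/
def DTree.eval {n : ℕ} {α : Type} : DTree n α → Cube n → α
  | .leaf a, _ => a
  | .node i lo hi, x => if x i = -1 then lo.eval x else hi.eval x

/-- `error_f(T)`: the probability over a uniform `x` that `f x ≠ T x`. -/
def error {n : ℕ} (f : Cube n → ℤˣ) (T : DTree n ℤˣ) : ℝ :=
  ((Finset.univ.filter fun x => f x ≠ T.eval x).card : ℝ) / 2 ^ n

/-- `opt_s(f)`: the least error of a decision tree with at most `s` leaves. -/
def opt {n : ℕ} (f : Cube n → ℤˣ) (s : ℕ) : ℝ :=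
  sInf (error f '' {T : DTree n ℤˣ | T.size ≤ s})

/-- A root-to-leaf path: the attributes queried on it, with their answers. Its length is the depth
of the leaf. -/
abbrev Path (n : ℕ) : Type := List (Fin n × ℤˣ)

/-- The leaves of a partial tree, each given by the path that leads to it. -/
def leaves {n : ℕ} : PTree n → Finset (Path n)
  | .leaf _ => {[]}
  | .node i lo hi =>
      (leaves lo).image (fun p => (i, (-1 : ℤˣ)) :: p) ∪ (leaves hi).image (fun p => (i, (1 : ℤˣ)) :: p)

/-- The subfunction `f_ℓ` for the leaf `ℓ` at the end of the path `p`, as a function on the whole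
cube that ignores the queried attributes. -/
def restrict {n : ℕ} {β : Type} (f : Cube n → β) : Path n → Cube n → β
  | [] => f
  | (i, b) :: p => restrict (fun x => f (Function.update x i b)) p

/-- The partial tree obtained by splitting the leaf at the end of the path `p` with a query
to the attribute `i`. -/
def split {n : ℕ} (i : Fin n) : PTree n → Path n → PTree n
  | .leaf _, _ => .node i (.leaf ()) (.leaf ())
  | .node j lo hi, (_, b) :: p =>
      if b = -1 then .node j (split i lo p) hi else .node j lo (split i hi p)
  | .node j lo hi, [] => .node j lo hi

/-! ### Computations with a step count -/

/-- A value together with the number of steps spent on computing it. -/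
structure Timed (α : Type) : Type where
  /-- the value that is computed -/
  val : α
  /-- the number of steps -/
  time : ℕ

instance : Monad Timed where
  pure a := ⟨a, 0⟩
  bind x g := ⟨(g x.val).val, x.time + (g x.val).time⟩

/-- Spend `k` elementary steps: an arithmetic operation or a comparison of real numbers, or the
handling of one attribute or of one node of a tree, is one step. -/
def tick (k : ℕ) : Timed Unit := ⟨(), k⟩

/-- A loop that adds up the values `g a`, `a ∈ s`, one addition for each. -/
def sumLoop {α : Type} (s : Finset α) (g : α → Timed ℝ) : Timed ℝ :=
  ⟨∑ a ∈ s, (g a).val, ∑ a ∈ s, ((g a).time + 1)⟩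

/-- A loop that computes `g a` for all `a ∈ s`, one comparison for each, and returns the result
with the largest real component; `tie` selects among the maximizers. -/
def maxLoop {α β : Type} (tie : Finset α → α) (s : Finset α) (g : α → Timed (β × ℝ)) :
    Timed (β × ℝ) :=
  ⟨(g (tie (s.filter fun a => ∀ b ∈ s, (g b).val.2 ≤ (g a).val.2))).val,
    ∑ a ∈ s, ((g a).time + 1)⟩

/-- A rule for breaking ties, between attributes at a leaf and between leaves. It may depend on the
current partial tree. -/
structure TieBreak (n : ℕ) : Type where
  /-- the choice among the attributes of largest influence at a leaf -/
  attr : PTree n → Path n → Finset (Fin n) → Fin n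
  /-- the choice among the leaves of largest score -/
  leaf : PTree n → Finset (Path n) → Path n
  attr_mem : ∀ T p s, s.Nonempty → attr T p s ∈ s
  leaf_mem : ∀ T s, s.Nonempty → leaf T s ∈ s

/-! ### The algorithm

The target function is accessed only through Fourier coefficients of its subfunctions, which are
obtained exactly; `charge k` is the number of steps charged for one coefficient of the subfunction
at a leaf of depth `k`. -/

/-- The Fourier coefficient at `S` of the subfunction at the leaf `p`. -/
def coeff {n : ℕ} (charge : ℕ → ℕ) (f : Cube n → ℤˣ) (p : Path n) (S : Finset (Fin n)) :
    Timed ℝ :=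
  ⟨fourierCoeff (restrict (toReal f) p) S, charge p.length⟩

/-- The `δ`-noisy `d`-wise influence of `i` on the subfunction at the leaf `p`, coefficient by
coefficient: besides the coefficient, a set `S` costs `|S|` steps for its enumeration, `|S|` for
the power, and two products. -/
def influence {n : ℕ} (charge : ℕ → ℕ) (f : Cube n → ℤˣ) (δ d : ℝ) (p : Path n) (i : Fin n) :
    Timed ℝ :=
  sumLoop (setsAt d i) fun S => do
    let a ← coeff charge f p S
    tick (2 * S.card + 2)
    return (1 - δ) ^ S.card * a ^ 2

theorem influence_val {n : ℕ} (charge : ℕ → ℕ) (f : Cube n → ℤˣ) (δ d : ℝ) (p : Path n)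
    (i : Fin n) :
    (influence charge f δ d p i).val = noisyInfluence δ d (restrict (toReal f) p) i := rfl

/-- The attribute with the largest noisy influence at the leaf `p` and the score
`2^{-|ℓ|} * Inf_i(f_ℓ)` of that leaf. -/
def scoreLeaf {n : ℕ} (charge : ℕ → ℕ) (f : Cube n → ℤˣ) (tie : TieBreak n) (δ d : ℝ)
    (T : PTree n) (p : Path n) : Timed (Fin n × ℝ) := do
  let r ← maxLoop (tie.attr T p) Finset.univ fun i => do
    let v ← influence charge f δ d p i
    return (i, v)
  tick (p.length + 1)
  return (r.1, (2 : ℝ)⁻¹ ^ p.length * r.2)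

/-- One round: score every leaf, and split a leaf of highest score with its attribute. -/
def round {n : ℕ} (charge : ℕ → ℕ) (f : Cube n → ℤˣ) (tie : TieBreak n) (δ d : ℝ)
    (T : PTree n) : Timed (PTree n) := do
  let r ← maxLoop (tie.leaf T) (leaves T) fun p => do
    let q ← scoreLeaf charge f tie δ d T p
    return ((p, q.1), q.2)
  tick (r.1.1.length + 1)
  return split r.1.2 T r.1.1

/-- `k` rounds of the loop. -/
def grow {n : ℕ} (charge : ℕ → ℕ) (f : Cube n → ℤˣ) (tie : TieBreak n) (δ d : ℝ) :
    ℕ → PTree n → Timed (PTree n)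
  | 0, T => do
      tick 1
      return T
  | k + 1, T => do
      tick 1
      let T' ← round charge f tie δ d T
      grow charge f tie δ d k T'

/-- The `f`-completion of the subtree that hangs at the end of the path `p`: every leaf is labelled
by the sign of the mean of its subfunction. -/
def complete {n : ℕ} (charge : ℕ → ℕ) (f : Cube n → ℤˣ) :
    Path n → PTree n → Timed (DTree n ℤˣ)
  | p, .leaf _ => do
      let a ← coeff charge f p ∅
      tick 1
      return .leaf (if 0 ≤ a then 1 else -1)
  | p, .node i lo hi => do
      tick 1
      let L ← complete charge f (p ++ [(i, -1)]) lo
      let H ← complete charge f (p ++ [(i, 1)]) hi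
      return .node i L H

/-- `BuildStabilizingDT_f(t, δ, ε)`, with `d = log(1/ε)/δ`. A round adds exactly one leaf, so that
the loop `while size < t`, started at the empty tree, is run `t - 1` times. One coefficient of a
subfunction at depth `k` is charged `charge ⌊d⌋ k` steps. -/
def buildStabilizingDT {n : ℕ} (charge : ℕ → ℕ → ℕ) (f : Cube n → ℤˣ) (tie : TieBreak n)
    (t : ℕ) (δ ε : ℝ) : Timed (DTree n ℤˣ) := do
  let d := Real.logb 2 (1 / ε) / δ
  let T ← grow (charge ⌊d⌋₊) f tie δ d (t - 1) (.leaf ())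
  complete (charge ⌊d⌋₊) f [] T

/-! ### Charges and rates -/

/-- The charge `poly(2^k, n^D)` for a coefficient at a leaf of depth `k`, with access through
uniform random examples, of which only a fraction `2^{-k}` reaches the leaf. -/
def exampleCharge (A n D k : ℕ) : ℕ := (2 ^ k * (n + 1) ^ (D + 1)) ^ A

/-- The charge `poly(k, n^D)` for a coefficient at a leaf of depth `k`, with access through exact
correlation queries. -/
def queryCharge (A n D k : ℕ) : ℕ := ((k + 1) * (n + 1) ^ (D + 1)) ^ A

/-- The bound `K * X * (log X)^c`, with `X = (log s)²/ε²`, behind `Õ((log s)²/ε²)`. -/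
def softBound (K : ℝ) (c s : ℕ) (ε : ℝ) : ℝ :=
  K * (Real.logb 2 s ^ 2 / ε ^ 2) * Real.logb 2 (Real.logb 2 s ^ 2 / ε ^ 2) ^ c

end StabDT

end

noncomputable section

namespace StabDT

/-! ### Expectations -/

section Expect

variable {n : ℕ}

/-! Two facts carry the proof. The first is a potential argument for the greedy rule. The average
noise stability of the leaf subfunctions (`potential`) lies in [0,1], and splitting a leaf of score
σ raises it by at least δσ (`stability_add_le`, `potential_split`). If the leaf-average of the
largest influence exceeds κ, the best score is at least κ divided by the number of leaves. After k
such rounds the potential is thus at least δκ times the k-th harmonic number, so the average drops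
to κ before round exp(1/(δκ)) (`exists_averageMaxInfluence_le`).

The second fact is that a Boolean g with small noisy influences that is close to a decision tree T
of size s is nearly constant (`bias_le`). Cut T at depth D, about log(s/ε), and let h be the noisy
low-degree part of g. The covariance of T and h is estimated twice. From below, on the Fourier side:
the total influence of T is at most its average depth, hence at most log s, so smoothing at rate δ =
ε/log s keeps a constant fraction of the variance of T, up to O(ε + dist(g,T)). From above, by a
hybrid argument (`walkChange_le`, `DTree.ReadOnce.covariance_le`): overwriting a uniform point by
the answers on a random path of T decouples the label of the leaf from the original point.
Overwriting changes h by little in mean square, since each single step costs only an influence of g.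
Together the two estimates bound the variance of T, and with it the bias of g.

At the first round with average at most κ, `bias_le` is applied at every leaf to the subfunction of
f and the restriction of a competing tree. Averaging over the leaves gives error at most 73·opt + ε
(`error_complete_le`). Up to that round every split has a large score. So no attribute repeats on a
path, and since a score is at most 2^{-depth}, leaves have depth O(log t₀); this makes the example
charge affordable (`leaves_treeAfter`). Later splits never increase the error
(`error_complete_split_le`), so the size t₀ works as well, and there depth < size suffices for the
query charge. -/

theorem expect_add (g h : Cube n → ℝ) :
    expect (fun x => g x + h x) = expect g + expect h := by
  simp [expect, Finset.sum_add_distrib, add_div]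

theorem expect_sub (g h : Cube n → ℝ) :
    expect (fun x => g x - h x) = expect g - expect h := by
  simp [expect, Finset.sum_sub_distrib, sub_div]

theorem expect_const_mul (c : ℝ) (g : Cube n → ℝ) :
    expect (fun x => c * g x) = c * expect g := by
  rw [expect, expect, ← Finset.mul_sum, mul_div_assoc]

theorem expect_mul_const (c : ℝ) (g : Cube n → ℝ) :
    expect (fun x => g x * c) = expect g * c := by
  simp only [mul_comm _ c, expect_const_mul]

theorem expect_sum {ι : Type*} (s : Finset ι) (g : ι → Cube n → ℝ) :
    expect (fun x => ∑ a ∈ s, g a x) = ∑ a ∈ s, expect (g a) := by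
  simp only [expect]
  rw [Finset.sum_comm, Finset.sum_div]

theorem expect_const (c : ℝ) : expect (fun _ : Cube n => c) = c := by
  simp [expect]

theorem expect_mono {g h : Cube n → ℝ} (H : ∀ x, g x ≤ h x) : expect g ≤ expect h := by
  unfold expect
  gcongr with x
  exact H x

theorem expect_nonneg {g : Cube n → ℝ} (H : ∀ x, 0 ≤ g x) : 0 ≤ expect g := by
  simpa [expect_const] using expect_mono (g := fun _ => 0) H

theorem unit_cases (u : ℤˣ) : u = -1 ∨ u = 1 := (Int.units_eq_one_or u).symm

theorem unit_sq (u : ℤˣ) : ((u : ℤ) : ℝ) * ((u : ℤ) : ℝ) = 1 := by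
  rcases unit_cases u with rfl | rfl <;> simp

theorem sum_units (F : ℤˣ → ℝ) : ∑ u, F u = F (-1) + F 1 := by
  rw [UnitsInt.univ, Finset.sum_pair (by decide), add_comm]

/-- Averaging over one coordinate first. -/
theorem expect_update (g : Cube n → ℝ) (i : Fin n) :
    expect g = (expect (fun x => g (Function.update x i (-1))) +
      expect (fun x => g (Function.update x i 1))) / 2 := by
  -- Flipping coordinate `i` permutes the cube, and the two updates of a point are the point and its
  -- flip in some order.
  have hinv : Function.Involutive fun x : Cube n => Function.update x i (-x i) := by
    intro x
    simp
  have h1 : expect (fun x => g (Function.update x i (-x i))) = expect g := by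
    unfold expect
    congr 1
    exact Equiv.sum_comp (hinv.toPerm) g
  have h2 : ∀ x, g (Function.update x i (-1)) + g (Function.update x i 1)
      = g x + g (Function.update x i (-x i)) := by
    intro x
    rcases unit_cases (x i) with h | h
    · rw [h, neg_neg]
      conv_lhs => rw [← h, Function.update_eq_self]
    · rw [h]
      conv_lhs => rw [add_comm]
      congr 1
      conv_lhs => rw [← h, Function.update_eq_self]
  rw [← expect_add]
  simp only [h2]
  rw [expect_add, h1]
  ring

theorem expect_prod (F : Fin n → ℤˣ → ℝ) :
    expect (fun x => ∏ i, F i (x i)) = ∏ i, ((F i (-1) + F i 1) / 2) := by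
  unfold expect
  rw [Finset.prod_div_distrib]
  simp only [← sum_units, Finset.prod_const, Finset.card_univ, Fintype.card_fin]
  rw [Finset.prod_univ_sum, Fintype.piFinset_univ]

end Expect

/-! ### Characters -/

section Characters

variable {n : ℕ}

/-- The character of the cube attached to a set of attributes. -/
def character (S : Finset (Fin n)) (x : Cube n) : ℝ := ∏ i ∈ S, ((x i : ℤ) : ℝ)

theorem fourierCoeff_eq (g : Cube n → ℝ) (S : Finset (Fin n)) :
    fourierCoeff g S = expect fun x => g x * character S x := rfl

theorem character_eq_prod_univ (S : Finset (Fin n)) (x : Cube n) :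
    character S x = ∏ i, if i ∈ S then ((x i : ℤ) : ℝ) else 1 := by
  simp [character, Finset.prod_ite_mem]

theorem expect_character_mul (S U : Finset (Fin n)) :
    expect (fun x => character S x * character U x) = if S = U then 1 else 0 := by
  simp only [character_eq_prod_univ, ← Finset.prod_mul_distrib]
  rw [expect_prod fun i u => (if i ∈ S then ((u : ℤ) : ℝ) else 1) *
    (if i ∈ U then ((u : ℤ) : ℝ) else 1)]
  split_ifs with h
  · subst h
    refine Finset.prod_eq_one fun i _ => ?_
    split_ifs <;> norm_num
  · obtain ⟨i, hi⟩ : ∃ i, ¬(i ∈ S ↔ i ∈ U) := by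
      by_contra! H
      exact h (Finset.ext H)
    refine Finset.prod_eq_zero (Finset.mem_univ i) ?_
    by_cases h1 : i ∈ S <;> by_cases h2 : i ∈ U <;> simp_all

theorem character_empty (x : Cube n) : character ∅ x = 1 := by simp [character]

theorem expect_character (S : Finset (Fin n)) :
    expect (character S) = if S = ∅ then 1 else 0 := by
  simpa [character_empty] using expect_character_mul S ∅

theorem expect_sq_sum_character (F : Finset (Finset (Fin n))) (c : Finset (Fin n) → ℝ) :
    expect (fun x => (∑ S ∈ F, c S * character S x) ^ 2) = ∑ S ∈ F, c S ^ 2 := by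
  have : ∀ x : Cube n, (∑ S ∈ F, c S * character S x) ^ 2 =
      ∑ S ∈ F, ∑ U ∈ F, (c S * c U) * (character S x * character U x) := by
    intro x
    rw [sq, Finset.sum_mul_sum]
    refine Finset.sum_congr rfl fun S _ => Finset.sum_congr rfl fun U _ => by ring
  simp only [this, expect_sum, expect_const_mul, expect_character_mul]
  refine Finset.sum_congr rfl fun S hS => ?_
  simp [hS, sq]

/-- Orthogonality in the dual variable: the sum over S factors as the product of the 1 + xᵢyᵢ. It
yields Parseval without an inversion formula. -/
theorem sum_character_mul (x y : Cube n) :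
    ∑ S, character S x * character S y = if x = y then 2 ^ n else 0 := by
  have h : ∀ S, character S x * character S y = ∏ i ∈ S, (((x i : ℤ) : ℝ) * ((y i : ℤ) : ℝ)) :=
    fun S => (Finset.prod_mul_distrib).symm
  simp only [h]
  rw [← Finset.powerset_univ, ← Finset.prod_one_add]
  split_ifs with hxy
  · subst hxy
    simp only [unit_sq]
    norm_num
  · obtain ⟨i, hi⟩ := Function.ne_iff.1 hxy
    refine Finset.prod_eq_zero (Finset.mem_univ i) ?_
    rcases unit_cases (x i) with h1 | h1 <;> rcases unit_cases (y i) with h2 | h2 <;> simp_all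

theorem parseval (g : Cube n → ℝ) :
    ∑ S, fourierCoeff g S ^ 2 = expect fun x => g x ^ 2 := by
  have h1 : ∀ S, fourierCoeff g S ^ 2 =
      (∑ x, ∑ y, g x * g y * (character S x * character S y)) / (2 ^ n * 2 ^ n) := by
    intro S
    rw [fourierCoeff_eq, expect, sq, div_mul_div_comm, Finset.sum_mul_sum]
    congr 1
    refine Finset.sum_congr rfl fun x _ => Finset.sum_congr rfl fun y _ => by ring
  simp only [h1]
  rw [← Finset.sum_div, Finset.sum_comm]
  have h2 : ∀ x : Cube n, ∑ S, ∑ y, g x * g y * (character S x * character S y) =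
      g x ^ 2 * 2 ^ n := by
    intro x
    rw [Finset.sum_comm]
    simp only [← Finset.mul_sum, sum_character_mul]
    simp [sq]
  simp only [h2, expect]
  rw [← Finset.sum_mul, mul_div_mul_right _ _ (by positivity)]

theorem fourierCoeff_empty (g : Cube n → ℝ) : fourierCoeff g ∅ = expect g := by
  simp [fourierCoeff]

theorem fourierCoeff_sub (g h : Cube n → ℝ) (S : Finset (Fin n)) :
    fourierCoeff (fun x => g x - h x) S = fourierCoeff g S - fourierCoeff h S := by
  simp only [fourierCoeff_eq, sub_mul, expect_sub]

theorem character_update_of_notMem {S : Finset (Fin n)} {i : Fin n} (hi : i ∉ S) (x : Cube n)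
    (b : ℤˣ) : character S (Function.update x i b) = character S x := by
  refine Finset.prod_congr rfl fun j hj => ?_
  rw [Function.update_of_ne]
  rintro rfl
  exact hi hj

theorem character_insert {S : Finset (Fin n)} {i : Fin n} (hi : i ∉ S) (x : Cube n) :
    character (insert i S) x = ((x i : ℤ) : ℝ) * character S x := by
  simp [character, Finset.prod_insert hi]

/-- The contributions of the two values of coordinate `i` cancel. -/
theorem fourierCoeff_eq_zero {g : Cube n → ℝ} {i : Fin n}
    (hg : ∀ x b, g (Function.update x i b) = g x) {S : Finset (Fin n)} (hi : i ∈ S) :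
    fourierCoeff g S = 0 := by
  obtain ⟨U, hU, rfl⟩ : ∃ U, i ∉ U ∧ insert i U = S :=
    ⟨S.erase i, Finset.notMem_erase i S, Finset.insert_erase hi⟩
  rw [fourierCoeff_eq, expect_update _ i]
  simp only [character_insert hU, character_update_of_notMem hU, hg, Function.update_self]
  rw [← expect_add]
  simp [expect_const]

theorem fourierCoeff_of_notMem (g : Cube n → ℝ) {S : Finset (Fin n)} {i : Fin n} (hi : i ∉ S) :
    fourierCoeff g S = (fourierCoeff (fun x => g (Function.update x i (-1))) S +
      fourierCoeff (fun x => g (Function.update x i 1)) S) / 2 := by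
  simp only [fourierCoeff_eq]
  rw [expect_update _ i]
  simp only [character_update_of_notMem hi]

theorem fourierCoeff_insert (g : Cube n → ℝ) {S : Finset (Fin n)} {i : Fin n} (hi : i ∉ S) :
    fourierCoeff g (insert i S) = (fourierCoeff (fun x => g (Function.update x i 1)) S -
      fourierCoeff (fun x => g (Function.update x i (-1))) S) / 2 := by
  simp only [fourierCoeff_eq]
  rw [expect_update _ i, ← expect_sub, ← expect_add]
  congr 2
  funext x
  simp only [character_insert hi, character_update_of_notMem hi, Function.update_self]
  simp
  ring

theorem sum_finset_split (i : Fin n) (F : Finset (Fin n) → ℝ) :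
    ∑ S, F S = ∑ S ∈ (Finset.univ.erase i).powerset, (F S + F (insert i S)) := by
  rw [Finset.sum_add_distrib, ← Finset.sum_powerset_insert (Finset.notMem_erase i _),
    Finset.insert_erase (Finset.mem_univ i), Finset.powerset_univ]

/-- How weighted Fourier mass changes when an attribute is fixed at random. -/
theorem sum_weight_update (g : Cube n → ℝ) (i : Fin n) (w : Finset (Fin n) → ℝ) :
    (∑ S, w S * fourierCoeff (fun x => g (Function.update x i (-1))) S ^ 2 +
      ∑ S, w S * fourierCoeff (fun x => g (Function.update x i 1)) S ^ 2) / 2 =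
    ∑ S, w (S.erase i) * fourierCoeff g S ^ 2 := by
  rw [← Finset.sum_add_distrib, sum_finset_split i, sum_finset_split i, Finset.sum_div]
  refine Finset.sum_congr rfl fun S hS => ?_
  have hi : i ∉ S := fun h => Finset.notMem_erase i _ (Finset.mem_powerset.1 hS h)
  rw [fourierCoeff_eq_zero (i := i) (by simp) (Finset.mem_insert_self i S),
    fourierCoeff_eq_zero (i := i) (by simp) (Finset.mem_insert_self i S),
    Finset.erase_insert hi, Finset.erase_eq_of_notMem hi, fourierCoeff_of_notMem g hi,
    fourierCoeff_insert g hi]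
  -- With a, b the coefficients of the two subfunctions at S, those of g at S and `insert i S` are
  -- their half sum and half difference, whose squares add up to (a² + b²)/2.
  ring

end Characters

/-! ### Signs -/

section Signs

variable {n : ℕ}

theorem toReal_sq (f : Cube n → ℤˣ) (x : Cube n) : toReal f x ^ 2 = 1 := by
  rw [sq]; exact unit_sq _

theorem sum_fourierCoeff_toReal_sq (f : Cube n → ℤˣ) : ∑ S, fourierCoeff (toReal f) S ^ 2 = 1 := by
  rw [parseval]
  simp [toReal_sq, expect_const]

theorem toReal_sub_sq (f g : Cube n → ℤˣ) (x : Cube n) :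
    (toReal f x - toReal g x) ^ 2 = 4 * if f x ≠ g x then 1 else 0 := by
  unfold toReal
  rcases unit_cases (f x) with h1 | h1 <;> rcases unit_cases (g x) with h2 | h2 <;>
    rw [h1, h2] <;> norm_num

/-- The distance of two Boolean functions. -/
def dist (f g : Cube n → ℤˣ) : ℝ := expect fun x => if f x ≠ g x then 1 else 0

theorem error_eq_dist (f : Cube n → ℤˣ) (T : DTree n ℤˣ) : error f T = dist f T.eval := by
  rw [error, dist, expect, Finset.sum_boole]

theorem dist_nonneg (f g : Cube n → ℤˣ) : 0 ≤ dist f g :=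
  expect_nonneg fun x => by split_ifs <;> norm_num

theorem dist_le_one (f g : Cube n → ℤˣ) : dist f g ≤ 1 := by
  rw [← expect_const (n := n) 1]
  exact expect_mono fun x => by split_ifs <;> norm_num

theorem dist_triangle (f g h : Cube n → ℤˣ) : dist f h ≤ dist f g + dist g h := by
  rw [dist, dist, dist, ← expect_add]
  refine expect_mono fun x => ?_
  by_cases h1 : f x = g x <;> by_cases h2 : g x = h x <;> simp_all
  split_ifs <;> norm_num

theorem expect_toReal_sub_sq (f g : Cube n → ℤˣ) :
    expect (fun x => (toReal f x - toReal g x) ^ 2) = 4 * dist f g := by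
  simp only [toReal_sub_sq, expect_const_mul, dist]

theorem dist_eq_expect_mul (f g : Cube n → ℤˣ) :
    dist f g = (1 - expect fun x => toReal f x * toReal g x) / 2 := by
  have : ∀ x, (if f x ≠ g x then (1 : ℝ) else 0) = 2⁻¹ + (-2⁻¹) * (toReal f x * toReal g x) := by
    intro x
    unfold toReal
    rcases unit_cases (f x) with h1 | h1 <;> rcases unit_cases (g x) with h2 | h2 <;>
      rw [h1, h2] <;> norm_num
  rw [dist]
  simp only [this, expect_add, expect_const_mul, expect_const]
  ring

theorem abs_expect_sub_le (f g : Cube n → ℤˣ) :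
    |expect (toReal f) - expect (toReal g)| ≤ 2 * dist f g := by
  rw [← expect_sub, dist, ← expect_const_mul, abs_le, neg_eq_neg_one_mul, ← expect_const_mul]
  constructor <;> refine expect_mono fun x => ?_ <;> unfold toReal <;>
    rcases unit_cases (f x) with h1 | h1 <;> rcases unit_cases (g x) with h2 | h2 <;>
      rw [h1, h2] <;> norm_num

end Signs

/-! ### Restricting and truncating decision trees -/

section Trees

variable {n : ℕ} {α : Type}

/-- The tree queries the attribute somewhere. -/
def DTree.Queries (i : Fin n) : DTree n α → Prop
  | .leaf _ => False
  | .node j lo hi => i = j ∨ lo.Queries i ∨ hi.Queries i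

/-- No attribute is queried twice on a path. -/
def DTree.ReadOnce : DTree n α → Prop
  | .leaf _ => True
  | .node i lo hi => ¬lo.Queries i ∧ ¬hi.Queries i ∧ lo.ReadOnce ∧ hi.ReadOnce

/-- The depth of a tree. -/
def DTree.depth : DTree n α → ℕ
  | .leaf _ => 0
  | .node _ lo hi => max lo.depth hi.depth + 1

/-- The expected length of a random walk from the root to a leaf. -/
def DTree.avgDepth : DTree n α → ℝ
  | .leaf _ => 0
  | .node _ lo hi => 1 + (lo.avgDepth + hi.avgDepth) / 2

/-- The tree for the subfunction where the attribute `i` is fixed to `b`. -/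
def DTree.fixAttr (i : Fin n) (b : ℤˣ) : DTree n α → DTree n α
  | .leaf a => .leaf a
  | .node j lo hi =>
      if j = i then (if b = -1 then lo.fixAttr i b else hi.fixAttr i b)
      else .node j (lo.fixAttr i b) (hi.fixAttr i b)

/-- The read-once tree that agrees with a given tree down to depth `D`, with `a` below. -/
def DTree.trunc (a : α) : ℕ → DTree n α → DTree n α
  | 0, _ => .leaf a
  | _ + 1, .leaf b => .leaf b
  | D + 1, .node i lo hi =>
      .node i (DTree.trunc a D (lo.fixAttr i (-1))) (DTree.trunc a D (hi.fixAttr i 1))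

theorem DTree.size_pos (T : DTree n α) : 1 ≤ T.size := by
  induction T with
  | leaf a => simp [DTree.size]
  | node i lo hi h1 h2 => simp only [DTree.size]; omega

theorem DTree.eval_fixAttr (i : Fin n) (b : ℤˣ) (T : DTree n α) (x : Cube n) :
    (T.fixAttr i b).eval x = T.eval (Function.update x i b) := by
  induction T with
  | leaf a => rfl
  | node j lo hi h1 h2 =>
    simp only [DTree.fixAttr]
    by_cases hj : j = i
    · subst hj
      by_cases hb : b = -1
      · subst hb
        simp [DTree.eval, h1]
      · simp [hb, DTree.eval, h2]
    · simp [hj, DTree.eval, h1, h2]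

theorem DTree.size_fixAttr_le (i : Fin n) (b : ℤˣ) (T : DTree n α) :
    (T.fixAttr i b).size ≤ T.size := by
  induction T with
  | leaf a => rfl
  | node j lo hi h1 h2 =>
    simp only [DTree.fixAttr]
    split_ifs <;> simp only [DTree.size] <;> omega

theorem DTree.not_queries_fixAttr (i : Fin n) (b : ℤˣ) (T : DTree n α) :
    ¬(T.fixAttr i b).Queries i := by
  induction T with
  | leaf a => exact id
  | node j lo hi h1 h2 =>
    simp only [DTree.fixAttr]
    split_ifs with hj
    · exact h1
    · exact h2
    · simp only [DTree.Queries]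
      rintro (h | h | h)
      exacts [hj h.symm, h1 h, h2 h]

theorem DTree.Queries.of_fixAttr {i j : Fin n} {b : ℤˣ} {T : DTree n α}
    (h : (T.fixAttr i b).Queries j) : T.Queries j := by
  induction T with
  | leaf a => exact h
  | node k lo hi h1 h2 =>
    simp only [DTree.fixAttr] at h
    simp only [DTree.Queries]
    split_ifs at h
    · exact .inr (.inl (h1 h))
    · exact .inr (.inr (h2 h))
    · rcases h with h | h | h
      exacts [.inl h, .inr (.inl (h1 h)), .inr (.inr (h2 h))]

theorem DTree.Queries.of_trunc {j : Fin n} {a : α} {D : ℕ} {T : DTree n α}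
    (h : (T.trunc a D).Queries j) : T.Queries j := by
  induction D generalizing T with
  | zero => exact h.elim
  | succ D ih =>
    cases T with
    | leaf b => exact h
    | node i lo hi =>
      rcases h with h | h | h
      exacts [.inl h, .inr (.inl (ih h).of_fixAttr), .inr (.inr (ih h).of_fixAttr)]

theorem DTree.readOnce_trunc (a : α) (D : ℕ) (T : DTree n α) : (T.trunc a D).ReadOnce := by
  induction D generalizing T with
  | zero => trivial
  | succ D ih =>
    cases T with
    | leaf b => trivial
    | node i lo hi =>
      exact ⟨fun h => lo.not_queries_fixAttr i _ h.of_trunc,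
        fun h => hi.not_queries_fixAttr i _ h.of_trunc, ih _, ih _⟩

theorem DTree.size_trunc_le (a : α) (D : ℕ) (T : DTree n α) : (T.trunc a D).size ≤ T.size := by
  induction D generalizing T with
  | zero => exact T.size_pos
  | succ D ih =>
    cases T with
    | leaf b => exact le_rfl
    | node i lo hi =>
      exact add_le_add ((ih _).trans (lo.size_fixAttr_le i _)) ((ih _).trans (hi.size_fixAttr_le i _))

theorem DTree.depth_trunc_le (a : α) (D : ℕ) (T : DTree n α) : (T.trunc a D).depth ≤ D := by
  induction D generalizing T with
  | zero => exact le_rfl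
  | succ D ih =>
    cases T with
    | leaf b => exact Nat.zero_le _
    | node i lo hi => exact Nat.succ_le_succ (max_le (ih _) (ih _))

theorem DTree.eval_update {i : Fin n} {T : DTree n α} (h : ¬T.Queries i) (x : Cube n) (b : ℤˣ) :
    T.eval (Function.update x i b) = T.eval x := by
  induction T with
  | leaf a => rfl
  | node j lo hi h1 h2 =>
    simp only [DTree.Queries, not_or] at h
    rw [DTree.eval, DTree.eval, h1 h.2.1, h2 h.2.2, Function.update_of_ne (Ne.symm h.1)]

theorem DTree.eval_node_neg (i : Fin n) (lo hi : DTree n α) (x : Cube n) :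
    (DTree.node i lo hi).eval (Function.update x i (-1)) = lo.eval (Function.update x i (-1)) := by
  simp [DTree.eval]

theorem DTree.eval_node_one (i : Fin n) (lo hi : DTree n α) (x : Cube n) :
    (DTree.node i lo hi).eval (Function.update x i 1) = hi.eval (Function.update x i 1) := by
  simp only [DTree.eval, Function.update_self]
  rw [if_neg (by decide)]

theorem dist_update (f g : Cube n → ℤˣ) (i : Fin n) :
    dist f g = (dist (fun x => f (Function.update x i (-1))) (fun x => g (Function.update x i (-1))) +
      dist (fun x => f (Function.update x i 1)) (fun x => g (Function.update x i 1))) / 2 :=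
  expect_update _ i

theorem dist_self (f : Cube n → ℤˣ) : dist f f = 0 := by
  simp [dist, expect_const]

/-- Disagreement needs a walk that gets to depth D, which has probability 2^{-D} for each of at most
`T.size` branches; in the induction the sizes of the two subtrees add up. -/
theorem dist_trunc_le (a : ℤˣ) (D : ℕ) (T : DTree n ℤˣ) :
    dist (T.trunc a D).eval T.eval ≤ T.size / 2 ^ D := by
  induction D generalizing T with
  | zero =>
    refine (dist_le_one _ _).trans ?_
    simpa using T.size_pos
  | succ D ih =>
    cases T with
    | leaf b =>
      rw [DTree.trunc, dist_self]
      positivity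
    | node i lo hi =>
      rw [dist_update _ _ i, DTree.trunc]
      simp only [DTree.eval_node_neg, DTree.eval_node_one]
      simp only [DTree.eval_update fun h => lo.not_queries_fixAttr i _ (DTree.Queries.of_trunc h),
        DTree.eval_update fun h => hi.not_queries_fixAttr i _ (DTree.Queries.of_trunc h),
        ← DTree.eval_fixAttr]
      have h1 := (ih (lo.fixAttr i (-1))).trans (div_le_div_of_nonneg_right
        (Nat.cast_le.2 (lo.size_fixAttr_le i (-1))) (by positivity))
      have h2 := (ih (hi.fixAttr i 1)).trans (div_le_div_of_nonneg_right
        (Nat.cast_le.2 (hi.size_fixAttr_le i 1)) (by positivity))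
      refine (div_le_div_of_nonneg_right (add_le_add h1 h2) zero_le_two).trans_eq ?_
      rw [DTree.size, pow_succ]
      push_cast
      field_simp

theorem DTree.avgDepth_nonneg (T : DTree n α) : 0 ≤ T.avgDepth := by
  induction T with
  | leaf a => exact le_rfl
  | node i lo hi h1 h2 => simp only [DTree.avgDepth]; positivity

/-- Induction by concavity of the logarithm, in the form 4ab ≤ (a + b)² for the sizes a, b of the
subtrees. -/
theorem DTree.avgDepth_le (T : DTree n α) : T.avgDepth ≤ Real.logb 2 T.size := by
  induction T with
  | leaf a => simp [DTree.avgDepth, DTree.size]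
  | node i lo hi h1 h2 =>
    have ha : (0 : ℝ) < lo.size := Nat.cast_pos.2 lo.size_pos
    have hb : (0 : ℝ) < hi.size := Nat.cast_pos.2 hi.size_pos
    simp only [DTree.avgDepth, DTree.size]
    push_cast
    have h4 : Real.logb 2 (4 * (lo.size * hi.size : ℝ)) ≤
        Real.logb 2 ((lo.size + hi.size : ℝ) ^ 2) := by
      refine Real.logb_le_logb_of_le one_lt_two (by positivity) ?_
      nlinarith [sq_nonneg ((lo.size : ℝ) - hi.size)]
    rw [Real.logb_mul (by norm_num) (by positivity), Real.logb_mul (by positivity) (by positivity),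
      Real.logb_pow, show (4 : ℝ) = 2 ^ (2 : ℕ) by norm_num, Real.logb_pow,
      Real.logb_self_eq_one one_lt_two] at h4
    push_cast at h4
    linarith

/-- The total influence of a tree is at most its average depth. -/
theorem DTree.ReadOnce.totalInfluence_le {T : DTree n ℤˣ} (hT : T.ReadOnce) :
    ∑ S, (S.card : ℝ) * fourierCoeff (toReal T.eval) S ^ 2 ≤ T.avgDepth := by
  induction T with
  | leaf a =>
    refine (Finset.sum_eq_zero fun S _ => ?_).le
    rcases S.eq_empty_or_nonempty with rfl | ⟨i, hi⟩
    · simp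
    · rw [fourierCoeff_eq_zero (i := i) (fun _ _ => rfl) hi]
      simp
  | node i lo hi h1 h2 =>
    obtain ⟨q1, q2, r1, r2⟩ := hT
    have h := sum_weight_update (toReal (DTree.node i lo hi).eval) i fun S => (S.card : ℝ)
    have e1 : (fun x => toReal (DTree.node i lo hi).eval (Function.update x i (-1))) =
        toReal lo.eval := by
      funext x
      rw [toReal, DTree.eval_node_neg, DTree.eval_update q1, toReal]
    have e2 : (fun x => toReal (DTree.node i lo hi).eval (Function.update x i 1)) =
        toReal hi.eval := by
      funext x
      rw [toReal, DTree.eval_node_one, DTree.eval_update q2, toReal]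
    rw [e1, e2] at h
    have h3 := h1 r1
    have h4 := h2 r2
    -- Fixing the root attribute lowers each |S| by at most one. By Parseval the total loss is at
    -- most 1, which is what the root adds to the average depth.
    have h5 : ∑ S, (S.card : ℝ) * fourierCoeff (toReal (DTree.node i lo hi).eval) S ^ 2 ≤
        ∑ S, ((S.erase i).card : ℝ) * fourierCoeff (toReal (DTree.node i lo hi).eval) S ^ 2 +
          ∑ S, fourierCoeff (toReal (DTree.node i lo hi).eval) S ^ 2 := by
      rw [← Finset.sum_add_distrib]
      refine Finset.sum_le_sum fun S _ => ?_
      have : (S.card : ℝ) ≤ (S.erase i).card + 1 := by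
        exact_mod_cast Nat.le_add_of_sub_le Finset.pred_card_le_card_erase
      nlinarith [sq_nonneg (fourierCoeff (toReal (DTree.node i lo hi).eval) S)]
    rw [sum_fourierCoeff_toReal_sq] at h5
    simp only [DTree.avgDepth]
    linarith

end Trees

/-! ### Replacing the answers on a random path -/

section Walk

variable {n : ℕ} {α : Type}

/-- The mean of `Φ z a` over a random walk from the root, where `a` is the label of the leaf that is
reached and `z` is `y` with the answers of the walk put in. -/
def walkMean : DTree n α → (Cube n → α → ℝ) → Cube n → ℝ
  | .leaf a, Φ, y => Φ y a
  | .node i lo hi, Φ, y =>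
      (walkMean lo (fun z a => Φ (Function.update z i (-1)) a) y +
        walkMean hi (fun z a => Φ (Function.update z i 1) a) y) / 2

theorem walkMean_add (T : DTree n α) (Φ Ψ : Cube n → α → ℝ) (y : Cube n) :
    walkMean T (fun z a => Φ z a + Ψ z a) y = walkMean T Φ y + walkMean T Ψ y := by
  induction T generalizing Φ Ψ with
  | leaf a => rfl
  | node i lo hi h1 h2 => simp only [walkMean, h1, h2]; ring

theorem walkMean_const_mul (T : DTree n α) (c : ℝ) (Φ : Cube n → α → ℝ) (y : Cube n) :
    walkMean T (fun z a => c * Φ z a) y = c * walkMean T Φ y := by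
  induction T generalizing Φ with
  | leaf a => rfl
  | node i lo hi h1 h2 => simp only [walkMean, h1, h2]; ring

theorem walkMean_mono (T : DTree n α) {Φ Ψ : Cube n → α → ℝ} (h : ∀ z a, Φ z a ≤ Ψ z a)
    (y : Cube n) : walkMean T Φ y ≤ walkMean T Ψ y := by
  induction T generalizing Φ Ψ with
  | leaf a => exact h _ _
  | node i lo hi h1 h2 =>
    exact div_le_div_of_nonneg_right (add_le_add (h1 fun _ _ => h _ _) (h2 fun _ _ => h _ _))
      zero_le_two

/-- The walk tosses its own coins, so the leaf it reaches is independent of the starting point. -/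
theorem walkMean_label (T : DTree n α) (φ : α → ℝ) (y y' : Cube n) :
    walkMean T (fun _ a => φ a) y = walkMean T (fun _ a => φ a) y' := by
  induction T with
  | leaf a => rfl
  | node i lo hi h1 h2 => simp only [walkMean, h1, h2]

/-- The point `z` of the walk is uniformly distributed. -/
theorem expect_walkMean (T : DTree n α) (H : Cube n → ℝ) :
    expect (walkMean T fun z _ => H z) = expect H := by
  induction T generalizing H with
  | leaf a => rfl
  | node i lo hi h1 h2 =>
    rw [expect_update H i, ← h1 fun x => H (Function.update x i (-1)),
      ← h2 fun x => H (Function.update x i 1), ← expect_add, div_eq_mul_inv, ← expect_mul_const]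
    rfl

/-- The answers of the subtree are put in before that of its root. Without repeated attributes
nothing is overwritten, so evaluating the tree at the final point retraces the walk. -/
theorem DTree.ReadOnce.walkMean_eq {T : DTree n α} (hT : T.ReadOnce) (Φ : Cube n → α → ℝ)
    (y : Cube n) : walkMean T Φ y = walkMean T (fun z _ => Φ z (T.eval z)) y := by
  induction T generalizing Φ with
  | leaf a => rfl
  | node i lo hi h1 h2 =>
    obtain ⟨q1, q2, r1, r2⟩ := hT
    simp only [walkMean, DTree.eval_node_neg, DTree.eval_node_one, DTree.eval_update q1,
      DTree.eval_update q2]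
    rw [h1 r1, h2 r2]

/-- The mean squared change of `h` along the walk. -/
def walkChange (T : DTree n α) (h : Cube n → ℝ) : ℝ :=
  expect fun y => walkMean T (fun z _ => (h z - h y) ^ 2) y

/-- One hybrid step. The change splits into the subtree's walk from y to z and the last update at
`i`; by `expect_walkMean` the point z is uniform, so the last update is a plain rerandomization.
Cauchy–Schwarz is used with weights D + 1 and (D + 1)/D, which makes the loss linear in D over the
whole path; D = 0 is separate because of the division. -/
theorem expect_walkMean_update_le {D : ℕ} {T : DTree n α} (hD : T.depth ≤ D) (h : Cube n → ℝ)
    {B : ℝ} (hB0 : 0 ≤ B) (hB : walkChange T h ≤ D * B) (i : Fin n) (b : ℤˣ) :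
    expect (fun y => walkMean T (fun z _ => (h (Function.update z i b) - h y) ^ 2) y) ≤
      (D + 1) * expect (fun z => (h (Function.update z i b) - h z) ^ 2) + (D + 1) * B := by
  rcases D.eq_zero_or_pos with rfl | hD0
  · cases T with
    | leaf a => simpa [walkMean] using hB0
    | node j lo hi => simp [DTree.depth] at hD
  · have hD' : (0 : ℝ) < D := Nat.cast_pos.2 hD0
    have key : ∀ y, walkMean T (fun z _ => (h (Function.update z i b) - h y) ^ 2) y ≤
        (D + 1) * walkMean T (fun z _ => (h (Function.update z i b) - h z) ^ 2) y +
          (D + 1) / D * walkMean T (fun z _ => (h z - h y) ^ 2) y := by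
      intro y
      rw [← walkMean_const_mul, ← walkMean_const_mul, ← walkMean_add]
      refine walkMean_mono T (fun z _ => ?_) y
      rw [← sub_nonneg]
      have e : (D + 1) * (h (Function.update z i b) - h z) ^ 2 + (D + 1) / D * (h z - h y) ^ 2 -
          (h (Function.update z i b) - h y) ^ 2 =
          (D * (h (Function.update z i b) - h z) - (h z - h y)) ^ 2 / D := by
        field_simp
        ring
      rw [e]
      positivity
    refine (expect_mono key).trans ?_
    rw [expect_add, expect_const_mul, expect_const_mul, expect_walkMean]
    refine add_le_add_right ?_ _
    calc (D + 1) / D * walkChange T h ≤ (D + 1) / D * (D * B) := by gcongr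
      _ = (D + 1) * B := by field_simp

/-- The reverse hybrid argument. -/
theorem walkChange_le {h : Cube n → ℝ} {M : ℝ}
    (hM : ∀ i, (expect (fun z => (h (Function.update z i (-1)) - h z) ^ 2) +
      expect (fun z => (h (Function.update z i 1) - h z) ^ 2)) / 2 ≤ M) (D : ℕ)
    (T : DTree n α) (hD : T.depth ≤ D) : walkChange T h ≤ D * (T.avgDepth * M) := by
  induction D generalizing T with
  | zero =>
    cases T with
    | leaf a => simp [walkChange, walkMean, DTree.avgDepth, expect_const]
    | node i lo hi => simp [DTree.depth] at hD
  | succ D ih =>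
    cases T with
    | leaf a => simp [walkChange, walkMean, DTree.avgDepth, expect_const]
    | node i lo hi =>
      simp only [DTree.depth, add_le_add_iff_right, max_le_iff] at hD
      have hM0 : 0 ≤ M := (div_nonneg (add_nonneg (expect_nonneg fun _ => sq_nonneg _)
        (expect_nonneg fun _ => sq_nonneg _)) zero_le_two).trans (hM i)
      -- The root answer is put in last, after the walk of the subtree belonging to that answer, so
      -- each subtree meets a uniform point. Averaging over the two answers turns the single-update
      -- terms into the quantity bounded by `hM`.
      have h1 := expect_walkMean_update_le hD.1 h (mul_nonneg lo.avgDepth_nonneg hM0) (ih lo hD.1) i (-1)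
      have h2 := expect_walkMean_update_le hD.2 h (mul_nonneg hi.avgDepth_nonneg hM0) (ih hi hD.2) i 1
      have h3 : walkChange (DTree.node i lo hi) h =
          (expect (fun y => walkMean lo (fun z _ => (h (Function.update z i (-1)) - h y) ^ 2) y) +
          expect (fun y => walkMean hi (fun z _ => (h (Function.update z i 1) - h y) ^ 2) y)) / 2 := by
        rw [← expect_add, div_eq_mul_inv, ← expect_mul_const]
        rfl
      have h4 := mul_le_mul_of_nonneg_left (hM i) (by positivity : (0 : ℝ) ≤ D + 1)
      rw [h3, DTree.avgDepth]
      push_cast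
      linarith

theorem expect_sub_mean_sq (T : Cube n → ℤˣ) :
    expect (fun x => (toReal T x - expect (toReal T)) ^ 2) = 1 - expect (toReal T) ^ 2 := by
  have : ∀ x, (toReal T x - expect (toReal T)) ^ 2 =
      (1 + expect (toReal T) ^ 2) + -2 * expect (toReal T) * toReal T x := by
    intro x
    linear_combination toReal_sq T x
  simp only [this, expect_add, expect_const, expect_const_mul]
  ring

/-- The covariance of a decision tree with `h` is controlled by its own variance and the change of
`h` along a random path of the tree. -/
theorem DTree.ReadOnce.covariance_le {T : DTree n ℤˣ} (hT : T.ReadOnce) (h : Cube n → ℝ) {η : ℝ}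
    (hη : 0 < η) :
    expect (fun x => toReal T.eval x * h x) - expect (toReal T.eval) * expect h ≤
      η * (1 - expect (toReal T.eval) ^ 2) + walkChange T h / (4 * η) := by
  set μ := expect (toReal T.eval) with hμ
  -- The inequality uv ≤ ηu² + v²/(4η), with u the centred label and v the change of `h` along the
  -- walk.
  have key : ∀ y, walkMean T (fun z a => (((a : ℤ) : ℝ) - μ) * (h z - h y)) y ≤
      η * walkMean T (fun _ a => (((a : ℤ) : ℝ) - μ) ^ 2) y +
        1 / (4 * η) * walkMean T (fun z _ => (h z - h y) ^ 2) y := by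
    intro y
    rw [← walkMean_const_mul, ← walkMean_const_mul, ← walkMean_add]
    refine walkMean_mono T (fun z a => ?_) y
    have := sq_nonneg (2 * η * (((a : ℤ) : ℝ) - μ) - (h z - h y))
    rw [← sub_nonneg]
    have e : η * (((a : ℤ) : ℝ) - μ) ^ 2 + 1 / (4 * η) * (h z - h y) ^ 2 -
        (((a : ℤ) : ℝ) - μ) * (h z - h y) =
        (2 * η * (((a : ℤ) : ℝ) - μ) - (h z - h y)) ^ 2 / (4 * η) := by
      field_simp
      ring
    rw [e]
    positivity
  -- The label has mean μ for every starting point y, so the `h y` part of the product averages to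
  -- zero: this is the decoupling.
  have hconst : ∀ y, walkMean T (fun _ a => ((a : ℤ) : ℝ) - μ) y = 0 := by
    intro y
    have e : expect (walkMean T fun _ a => ((a : ℤ) : ℝ) - μ) = 0 := by
      rw [show (walkMean T fun _ a => ((a : ℤ) : ℝ) - μ) =
        walkMean T (fun z _ => ((T.eval z : ℤ) : ℝ) - μ) from funext fun y => hT.walkMean_eq _ y,
        expect_walkMean, expect_sub, expect_const]
      exact sub_self _
    rw [← e, ← expect_const (n := n) (walkMean T _ y)]
    exact congrArg expect (funext fun y' => walkMean_label T _ y y')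
  have hl : ∀ y, walkMean T (fun z a => (((a : ℤ) : ℝ) - μ) * (h z - h y)) y =
      walkMean T (fun z _ => toReal T.eval z * h z + -μ * h z) y := by
    intro y
    have e : (fun (z : Cube n) (a : ℤˣ) => (((a : ℤ) : ℝ) - μ) * (h z - h y)) =
        fun z (a : ℤˣ) => (((a : ℤ) : ℝ) - μ) * h z + -h y * (((a : ℤ) : ℝ) - μ) := by
      funext z a
      ring
    rw [e, walkMean_add, walkMean_const_mul, hconst, mul_zero, add_zero, hT.walkMean_eq]
    congr 1
    funext z _
    rw [toReal]
    ring
  have hv : expect (walkMean T fun _ a => (((a : ℤ) : ℝ) - μ) ^ 2) = 1 - μ ^ 2 := by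
    rw [show (walkMean T fun _ a => (((a : ℤ) : ℝ) - μ) ^ 2) =
      walkMean T (fun z _ => (toReal T.eval z - μ) ^ 2) from funext fun y => hT.walkMean_eq _ y,
      expect_walkMean, expect_sub_mean_sq]
  have := expect_mono key
  simp only [hl] at this
  rw [expect_walkMean, expect_add, expect_const_mul, expect_add, expect_const_mul,
    expect_const_mul] at this
  change _ ≤ η * expect (walkMean T fun _ a => (((a : ℤ) : ℝ) - μ) ^ 2) +
    1 / (4 * η) * walkChange T h at this
  rw [hv] at this
  calc _ = expect (fun x => toReal T.eval x * h x) + -μ * expect h := by ring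
    _ ≤ _ := this
    _ = _ := by ring

end Walk

/-! ### Smoothed low-degree parts -/

section Smooth

variable {n : ℕ}

/-- The function with the Fourier coefficients `c`. -/
def fourierSum (c : Finset (Fin n) → ℝ) (x : Cube n) : ℝ := ∑ S, c S * character S x

theorem expect_mul_fourierSum (g : Cube n → ℝ) (c : Finset (Fin n) → ℝ) :
    expect (fun x => g x * fourierSum c x) = ∑ S, c S * fourierCoeff g S := by
  simp only [fourierSum, Finset.mul_sum, expect_sum, fourierCoeff_eq, ← expect_const_mul]
  refine Finset.sum_congr rfl fun S _ => congrArg expect (funext fun x => by ring)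

theorem expect_fourierSum (c : Finset (Fin n) → ℝ) : expect (fourierSum c) = c ∅ := by
  have : fourierSum c = fun x => ∑ S, c S * character S x := rfl
  rw [this, expect_sum]
  simp only [expect_const_mul, expect_character]
  simp

theorem fourierSum_update_sub (c : Finset (Fin n) → ℝ) (i : Fin n) (b : ℤˣ) (z : Cube n) :
    fourierSum c (Function.update z i b) - fourierSum c z =
      (((b : ℤ) : ℝ) - ((z i : ℤ) : ℝ)) *
        ∑ U ∈ (Finset.univ.erase i).powerset, c (insert i U) * character U z := by
  rw [fourierSum, fourierSum, ← Finset.sum_sub_distrib, sum_finset_split i, Finset.mul_sum]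
  refine Finset.sum_congr rfl fun S hS => ?_
  have hi : i ∉ S := fun h => Finset.notMem_erase i _ (Finset.mem_powerset.1 hS h)
  simp only [character_insert hi, character_update_of_notMem hi, Function.update_self]
  ring

/-- Rerandomizing one coordinate. -/
theorem expect_fourierSum_update_sub_sq (c : Finset (Fin n) → ℝ) (i : Fin n) :
    (expect (fun z => (fourierSum c (Function.update z i (-1)) - fourierSum c z) ^ 2) +
      expect (fun z => (fourierSum c (Function.update z i 1) - fourierSum c z) ^ 2)) / 2 =
      2 * ∑ S, if i ∈ S then c S ^ 2 else 0 := by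
  have h1 : ∀ z : Cube n, (fourierSum c (Function.update z i (-1)) - fourierSum c z) ^ 2 +
      (fourierSum c (Function.update z i 1) - fourierSum c z) ^ 2 =
      4 * (∑ U ∈ (Finset.univ.erase i).powerset, c (insert i U) * character U z) ^ 2 := by
    intro z
    rw [fourierSum_update_sub, fourierSum_update_sub]
    have := unit_sq (z i)
    push_cast
    linear_combination 2 *
      (∑ U ∈ (Finset.univ.erase i).powerset, c (insert i U) * character U z) ^ 2 * this
  rw [← expect_add]
  simp only [h1]
  rw [expect_const_mul, expect_sq_sum_character _ fun U => c (insert i U),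
    sum_finset_split i fun S => if i ∈ S then c S ^ 2 else 0]
  have h2 : ∀ U ∈ (Finset.univ.erase i).powerset,
      ((if i ∈ U then c U ^ 2 else 0) + if i ∈ insert i U then c (insert i U) ^ 2 else 0) =
        c (insert i U) ^ 2 := by
    intro U hU
    rw [if_neg fun h => Finset.notMem_erase i _ (Finset.mem_powerset.1 hU h),
      if_pos (Finset.mem_insert_self i U), zero_add]
  rw [Finset.sum_congr rfl h2]
  ring

/-- The multiplier of the noise operator of rate `√(1 - δ)`, cut off above degree `d`. -/
def noiseWeight (δ d : ℝ) (k : ℕ) : ℝ := if (k : ℝ) ≤ d then Real.sqrt (1 - δ) ^ k else 0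

/-- The noisy low-degree part of `g`. -/
def smooth (δ d : ℝ) (g : Cube n → ℝ) : Cube n → ℝ :=
  fourierSum fun S => noiseWeight δ d S.card * fourierCoeff g S

/-- The square root in `noiseWeight` is chosen so that squared coefficients carry exactly the weight
(1 - δ)^|S| of the influence. -/
theorem smooth_update_sub_sq {δ : ℝ} (hδ : δ ≤ 1) (d : ℝ) (g : Cube n → ℝ) (i : Fin n) :
    (expect (fun z => (smooth δ d g (Function.update z i (-1)) - smooth δ d g z) ^ 2) +
      expect (fun z => (smooth δ d g (Function.update z i 1) - smooth δ d g z) ^ 2)) / 2 =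
      2 * noisyInfluence δ d g i := by
  rw [smooth, expect_fourierSum_update_sub_sq, noisyInfluence, setsAt, Finset.sum_filter]
  congr 1
  refine Finset.sum_congr rfl fun S _ => ?_
  by_cases h1 : i ∈ S <;> by_cases h2 : (S.card : ℝ) ≤ d <;> simp [h1, h2, noiseWeight]
  rw [mul_pow, ← pow_mul, mul_comm S.card 2, pow_mul, Real.sq_sqrt (by linarith)]

theorem noiseWeight_nonneg (δ d : ℝ) (k : ℕ) : 0 ≤ noiseWeight δ d k := by
  unfold noiseWeight
  split_ifs <;> positivity

theorem sqrt_one_sub_le_one {δ : ℝ} (h0 : 0 ≤ δ) : Real.sqrt (1 - δ) ≤ 1 :=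
  Real.sqrt_le_iff.2 ⟨zero_le_one, by linarith⟩

theorem noiseWeight_le_one {δ : ℝ} (h0 : 0 ≤ δ) (d : ℝ) (k : ℕ) : noiseWeight δ d k ≤ 1 := by
  unfold noiseWeight
  split_ifs
  · exact pow_le_one₀ (Real.sqrt_nonneg _) (sqrt_one_sub_le_one h0)
  · exact zero_le_one

/-- Up to degree d this follows from Bernoulli's inequality and 1 - √(1-δ) ≤ δ/1.7. Above d the
weight is zero, but there δk ≥ 1, so the power is at most e^{-1/2} < 0.61 and Bernoulli makes the
left side nonpositive; 0.39 is 1 - 0.61. -/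
theorem noiseWeight_ge {δ d : ℝ} (h0 : 0 ≤ δ) (h1 : δ ≤ 1 / 2) (hd : 1 ≤ δ * d) (k : ℕ) :
    39 / 100 - δ / (17 / 10) * k ≤ noiseWeight δ d k := by
  have hr1 := sqrt_one_sub_le_one h0
  have hr2 : 7 / 10 ≤ Real.sqrt (1 - δ) := Real.le_sqrt_of_sq_le (by linarith)
  have hsq : Real.sqrt (1 - δ) ^ 2 = 1 - δ := Real.sq_sqrt (by linarith)
  have hb : 1 - k * (δ / (17 / 10)) ≤ Real.sqrt (1 - δ) ^ k := by
    have h := one_add_mul_le_pow (a := Real.sqrt (1 - δ) - 1) (by linarith) k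
    have h' : 1 - Real.sqrt (1 - δ) ≤ δ / (17 / 10) := by
      rw [le_div_iff₀ (by norm_num)]
      nlinarith
    rw [add_sub_cancel] at h
    have := mul_le_mul_of_nonneg_left h' (Nat.cast_nonneg (α := ℝ) k)
    linarith
  unfold noiseWeight
  split_ifs with hk
  · linarith
  · have h2 : Real.sqrt (1 - δ) ^ k ≤ 61 / 100 := by
      refine le_of_sq_le_sq ?_ (by norm_num)
      rw [← pow_mul, mul_comm k 2, pow_mul, hsq]
      calc (1 - δ) ^ k ≤ Real.exp (-δ) ^ k := by
            refine pow_le_pow_left₀ (by linarith) ?_ k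
            have := Real.add_one_le_exp (-δ)
            linarith
        _ = Real.exp (-(δ * k)) := by rw [← Real.exp_nat_mul]; ring_nf
        _ ≤ Real.exp (-1) := by
            rw [Real.exp_le_exp]
            have := mul_le_mul_of_nonneg_left (not_le.1 hk).le h0
            linarith
        _ ≤ _ := by
            have := Real.exp_neg_one_lt_d9
            norm_num at this ⊢
            linarith
    linarith

/-- A Boolean function that is close to a shallow decision tree and has small noisy influences
is nearly constant. -/
theorem bias_le_of_readOnce {g : Cube n → ℤˣ} {T : DTree n ℤˣ} (hT : T.ReadOnce) {D : ℕ}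
    (hD : T.depth ≤ D) {L ε δ d M : ℝ} (hL : T.avgDepth ≤ L) (hδL : δ * L = ε) (h0 : 0 ≤ δ)
    (h1 : δ ≤ 1 / 2) (hd : 1 ≤ δ * d)
    (hM0 : 0 ≤ M) (hM : ∀ i, noisyInfluence δ d (toReal g) i ≤ M) :
    (1 - |expect (toReal g)|) / 2 ≤
      ε / (119 / 100) + 73 * dist g T.eval + 36 * (D * L * M) := by
  have hd0 : 0 ≤ d := by
    by_contra! h
    nlinarith
  set t := toReal T.eval with ht
  set h := smooth δ d (toReal g) with hh
  set w : Finset (Fin n) → ℝ := fun S => noiseWeight δ d S.card with hw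
  -- This η must stay well below the fraction 0.39 of the variance that survives smoothing.
  have hcov := hT.covariance_le h (η := 1 / 50) (by norm_num)
  have hQ : walkChange T h ≤ D * (T.avgDepth * (2 * M)) := by
    refine walkChange_le (fun i => ?_) D T hD
    rw [hh, smooth_update_sub_sq (by linarith)]
    linarith [hM i]
  have hQ' : walkChange T h ≤ 2 * (D * L * M) := by
    refine hQ.trans ?_
    have := mul_le_mul_of_nonneg_left (mul_le_mul_of_nonneg_right hL hM0)
      (Nat.cast_nonneg (α := ℝ) D)
    linarith
  have e1 : expect (fun x => t x * h x) = ∑ S, w S * fourierCoeff (toReal g) S * fourierCoeff t S :=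
    expect_mul_fourierSum _ _
  have e2 : expect h = fourierCoeff (toReal g) ∅ := by
    rw [hh, smooth, expect_fourierSum, noiseWeight, Finset.card_empty, Nat.cast_zero, if_pos hd0,
      pow_zero, one_mul]
  have hp1 : ∑ S, fourierCoeff t S ^ 2 = 1 := sum_fourierCoeff_toReal_sq _
  have hp2 : ∑ S, (fourierCoeff (toReal g) S - fourierCoeff t S) ^ 2 = 4 * dist g T.eval := by
    rw [← expect_toReal_sub_sq, ← parseval]
    exact Finset.sum_congr rfl fun S _ => by rw [fourierCoeff_sub]
  have hp3 := hT.totalInfluence_le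
  have e3 : fourierCoeff t ∅ = expect t := fourierCoeff_empty t
  -- Lower bound for the covariance. The terms at the empty set cancel on the right. Elsewhere the
  -- coefficient of g is written as a + b, with a the coefficient of the tree; 37/100 is 39/100 -
  -- 1/50, where 1/50 is the cost of the cross term.
  have hsum : ∑ S, (37 / 100 * fourierCoeff t S ^ 2 -
      δ / (17 / 10) * (S.card * fourierCoeff t S ^ 2) -
      25 / 2 * (fourierCoeff (toReal g) S - fourierCoeff t S) ^ 2) - 37 / 100 * fourierCoeff t ∅ ^ 2 ≤
      ∑ S, w S * fourierCoeff (toReal g) S * fourierCoeff t S -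
        fourierCoeff t ∅ * fourierCoeff (toReal g) ∅ := by
    rw [← Finset.sum_erase_add _ _ (Finset.mem_univ ∅),
      ← Finset.sum_erase_add Finset.univ (fun S => w S * _ * _) (Finset.mem_univ ∅)]
    have hw0 : w ∅ = 1 := by simp [hw, noiseWeight, hd0]
    have hle : ∑ S ∈ Finset.univ.erase ∅, (37 / 100 * fourierCoeff t S ^ 2 -
        δ / (17 / 10) * (S.card * fourierCoeff t S ^ 2) -
        25 / 2 * (fourierCoeff (toReal g) S - fourierCoeff t S) ^ 2) ≤
        ∑ S ∈ Finset.univ.erase ∅, w S * fourierCoeff (toReal g) S * fourierCoeff t S := by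
      refine Finset.sum_le_sum fun S _ => ?_
      have w1 : 39 / 100 - δ / (17 / 10) * S.card ≤ w S := noiseWeight_ge h0 h1 hd _
      have w2 : 0 ≤ w S := noiseWeight_nonneg _ _ _
      have w3 : w S ≤ 1 := noiseWeight_le_one h0 _ _
      set a := fourierCoeff t S
      set b := fourierCoeff (toReal g) S - a with hb
      rw [show fourierCoeff (toReal g) S = a + b by ring]
      have h3 := mul_le_mul_of_nonneg_right w1 (sq_nonneg a)
      have h4 : -(1 / 50 * a ^ 2 + 25 / 2 * b ^ 2) ≤ w S * (a * b) := by
        have h5 : 0 ≤ w S * (1 / 50 * a ^ 2 + a * b + 25 / 2 * b ^ 2) := by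
          refine mul_nonneg w2 ?_
          nlinarith [sq_nonneg (1 / 5 * a + 5 * b)]
        have h6 : w S * (1 / 50 * a ^ 2 + 25 / 2 * b ^ 2) ≤ 1 / 50 * a ^ 2 + 25 / 2 * b ^ 2 :=
          mul_le_of_le_one_left (by positivity) w3
        linarith
      linarith
    rw [hw0]
    have hpos := sq_nonneg (fourierCoeff (toReal g) ∅ - fourierCoeff t ∅)
    simp only [Finset.card_empty, Nat.cast_zero, zero_mul, mul_zero, sub_zero]
    linarith
  rw [Finset.sum_sub_distrib, Finset.sum_sub_distrib, ← Finset.mul_sum, ← Finset.mul_sum,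
    ← Finset.mul_sum, hp1, hp2, e3] at hsum
  rw [← ht, e1, e2] at hcov
  have h7 : δ / (17 / 10) * ∑ S, (S.card : ℝ) * fourierCoeff t S ^ 2 ≤ ε / (17 / 10) := by
    calc _ ≤ δ / (17 / 10) * L := by
          refine mul_le_mul_of_nonneg_left (hp3.trans hL) (by positivity)
      _ = _ := by rw [← hδL]; ring
  have hvar : 35 / 100 * (1 - expect t ^ 2) ≤
      ε / (17 / 10) + 50 * dist g T.eval + 25 / 2 * (2 * (D * L * M)) := by
    have h8 := hsum.trans hcov
    have h9 : walkChange T h / (4 * (1 / 50)) ≤ 25 / 2 * (2 * (D * L * M)) := by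
      rw [div_le_iff₀ (by norm_num)]
      linarith
    linarith
  have habs : |expect t| ≤ |expect (toReal g)| + 2 * dist g T.eval := by
    have h8 := abs_expect_sub_le g T.eval
    have h9 := abs_sub_abs_le_abs_sub (expect t) (expect (toReal g))
    rw [abs_sub_comm] at h9
    linarith
  have ht1 : |expect t| ≤ 1 := by
    rw [← sq_le_one_iff_abs_le_one]
    have := (Finset.single_le_sum (f := fun S => fourierCoeff t S ^ 2)
      (fun S _ => sq_nonneg _) (Finset.mem_univ ∅))
    rw [hp1] at this
    simpa [e3] using this
  have h10 : 1 - |expect t| ≤ 1 - expect t ^ 2 := by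
    rw [← sq_abs]
    nlinarith [abs_nonneg (expect t)]
  have hdist := dist_nonneg g T.eval
  have hDLM : 0 ≤ D * L * M := mul_nonneg (mul_nonneg (Nat.cast_nonneg D)
    (T.avgDepth_nonneg.trans hL)) hM0
  -- Dividing `hvar` by 0.7 gives ε/(0.7·1.7) = ε/1.19, 50/0.7 for the distance and 25/0.7 < 36 for
  -- the influence term. Passing from the bias of the tree to that of g adds one more distance, and
  -- 50/0.7 + 1 < 73.
  linarith

/-- A Boolean function that is close to a small decision tree and has small noisy influences is
nearly constant. -/
theorem bias_le {g : Cube n → ℤˣ} {T : DTree n ℤˣ} {s D : ℕ} (hs : 2 ≤ s) (hTs : T.size ≤ s)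
    {ε δ d M : ℝ} (hε0 : 0 < ε) (hε : ε < 1 / 2) (hδ : δ = ε / Real.logb 2 s) (hd : 1 ≤ δ * d)
    (hD : 1000 * s / ε ≤ 2 ^ D) (hM0 : 0 ≤ M)
    (hM : ∀ i, noisyInfluence δ d (toReal g) i ≤ M) :
    (1 - |expect (toReal g)|) / 2 ≤
      92 / 100 * ε + 73 * dist g T.eval + 36 * (D * Real.logb 2 s) * M := by
  have hs' : (2 : ℝ) ≤ s := by exact_mod_cast hs
  have hL : 1 ≤ Real.logb 2 s := by
    rw [Real.le_logb_iff_rpow_le one_lt_two (by linarith)]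
    simpa using hs'
  have hδL : δ * Real.logb 2 s = ε := by
    rw [hδ]
    field_simp
  have h0 : 0 ≤ δ := by rw [hδ]; positivity
  have h1 : δ ≤ 1 / 2 := by nlinarith
  have hsz := T.size_trunc_le 1 D
  have havg : (T.trunc 1 D).avgDepth ≤ Real.logb 2 s := by
    refine (T.trunc 1 D).avgDepth_le.trans ?_
    refine Real.logb_le_logb_of_le one_lt_two ?_ ?_
    · exact_mod_cast (T.trunc 1 D).size_pos
    · exact_mod_cast hsz.trans hTs
  have h2 := bias_le_of_readOnce (g := g) (T.readOnce_trunc 1 D) (T.depth_trunc_le 1 D) havg hδL h0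
    h1 hd hM0 hM
  have h3 := dist_triangle g T.eval (T.trunc 1 D).eval
  have h4 : dist T.eval (T.trunc 1 D).eval ≤ ε / 1000 := by
    have h5 : dist T.eval (T.trunc 1 D).eval ≤ T.size / 2 ^ D := by
      have := dist_trunc_le 1 D T
      simpa only [dist, ne_comm] using this
    refine h5.trans ?_
    rw [div_le_div_iff₀ (by positivity) (by norm_num)]
    rw [div_le_iff₀ hε0] at hD
    have : (T.size : ℝ) ≤ s := by exact_mod_cast hTs
    linarith
  -- Truncation moves the tree by at most ε/1000, and 1/1.19 + 73/1000 < 0.92.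
  linarith

end Smooth

/-! ### Leaves and paths -/

section Leaves

variable {n : ℕ}

theorem sum_leaves_node (i : Fin n) (lo hi : PTree n) (F : Path n → ℝ) :
    ∑ p ∈ leaves (.node i lo hi), F p =
      ∑ p ∈ leaves lo, F ((i, -1) :: p) + ∑ p ∈ leaves hi, F ((i, 1) :: p) := by
  rw [leaves, Finset.sum_union, Finset.sum_image, Finset.sum_image]
  · exact fun p _ q _ h => (List.cons.inj h).2
  · exact fun p _ q _ h => (List.cons.inj h).2
  · rw [Finset.disjoint_left]
    intro p h1 h2
    obtain ⟨q, _, rfl⟩ := Finset.mem_image.1 h1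
    obtain ⟨r, _, h⟩ := Finset.mem_image.1 h2
    have h3 : (1 : ℤˣ) = -1 := congrArg Prod.snd (List.cons.inj h).1
    exact absurd h3 (by decide)

theorem card_leaves (T : PTree n) : (leaves T).card = T.size := by
  have h : (((leaves T).card : ℕ) : ℝ) = T.size := by
    rw [Finset.cast_card]
    induction T with
    | leaf a => simp [leaves, DTree.size]
    | node i lo hi h1 h2 => rw [sum_leaves_node, h1, h2, DTree.size, Nat.cast_add]
  exact_mod_cast h

theorem leaves_nonempty (T : PTree n) : (leaves T).Nonempty := by
  rw [← Finset.card_pos, card_leaves]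
  exact T.size_pos

theorem mem_leaves_node {i : Fin n} {lo hi : PTree n} {p : Path n} :
    p ∈ leaves (.node i lo hi) ↔
      (∃ q ∈ leaves lo, p = (i, -1) :: q) ∨ ∃ q ∈ leaves hi, p = (i, 1) :: q := by
  simp only [leaves, Finset.mem_union, Finset.mem_image, eq_comm]

theorem length_lt_size {T : PTree n} {p : Path n} (hp : p ∈ leaves T) : p.length < T.size := by
  induction T generalizing p with
  | leaf a => simp_all [leaves, DTree.size]
  | node i lo hi h1 h2 =>
    have := lo.size_pos
    have := hi.size_pos
    rw [DTree.size]
    rcases mem_leaves_node.1 hp with ⟨q, hq, rfl⟩ | ⟨q, hq, rfl⟩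
    · have := h1 hq
      rw [List.length_cons]
      omega
    · have := h2 hq
      rw [List.length_cons]
      omega

/-- Size, membership, error and potential after a split are all obtained from this identity by
choosing `F`. -/
theorem sum_leaves_split (i : Fin n) {T : PTree n} {p : Path n} (hp : p ∈ leaves T)
    (F : Path n → ℝ) :
    ∑ q ∈ leaves (split i T p), F q =
      ∑ q ∈ leaves T, F q - F p + (F (p ++ [(i, -1)]) + F (p ++ [(i, 1)])) := by
  induction T generalizing p F with
  | leaf a =>
    obtain rfl : p = [] := by simpa [leaves] using hp
    rw [split, sum_leaves_node]
    simp [leaves]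
  | node j lo hi h1 h2 =>
    rcases mem_leaves_node.1 hp with ⟨q, hq, rfl⟩ | ⟨q, hq, rfl⟩
    · rw [split, if_pos rfl, sum_leaves_node, sum_leaves_node, h1 hq fun r => F ((j, -1) :: r)]
      simp only [List.cons_append]
      ring
    · rw [split, if_neg (by decide), sum_leaves_node, sum_leaves_node,
        h2 hq fun r => F ((j, 1) :: r)]
      simp only [List.cons_append]
      ring

theorem mem_leaves_split {i : Fin n} {T : PTree n} {p q : Path n} (hp : p ∈ leaves T)
    (hq : q ∈ leaves (split i T p)) : q ∈ leaves T ∨ ∃ b, q = p ++ [(i, b)] := by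
  by_contra! h
  -- With the indicator of `q`, the identity would read 1 = 0 for a leaf that is neither old nor one
  -- of the two children.
  have h1 := sum_leaves_split i hp fun r => if r = q then 1 else 0
  have h2 : p ≠ q := fun e => h.1 (e ▸ hp)
  simp only [Finset.sum_ite_eq', if_pos hq, if_neg h.1, if_neg h2, if_neg (h.2 _).symm] at h1
  norm_num at h1

theorem size_split (i : Fin n) {T : PTree n} {p : Path n} (hp : p ∈ leaves T) :
    (split i T p).size = T.size + 1 := by
  have h := sum_leaves_split i hp fun _ => 1
  simp only [Finset.sum_const, card_leaves, nsmul_eq_mul, mul_one] at h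
  have h' : ((split i T p).size : ℝ) = ((T.size + 1 : ℕ) : ℝ) := by
    push_cast
    linarith
  exact_mod_cast h'

theorem restrict_append {β : Type} (f : Cube n → β) (p q : Path n) :
    restrict f (p ++ q) = restrict (restrict f p) q := by
  induction p generalizing f with
  | nil => rfl
  | cons a p ih => exact ih _

theorem restrict_toReal (f : Cube n → ℤˣ) (p : Path n) :
    restrict (toReal f) p = toReal (restrict f p) := by
  induction p generalizing f with
  | nil => rfl
  | cons a p ih => exact ih _

/-- A queried attribute has no influence left below its query; this is what later excludes repeated
queries. -/
theorem restrict_update_of_mem {β : Type} (f : Cube n → β) {p : Path n} {i : Fin n}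
    (hi : i ∈ p.map Prod.fst) (x : Cube n) (b : ℤˣ) :
    restrict f p (Function.update x i b) = restrict f p x := by
  have aux : ∀ (q : Path n) (g : Cube n → β), (∀ x b, g (Function.update x i b) = g x) →
      ∀ x b, restrict g q (Function.update x i b) = restrict g q x := by
    intro q
    induction q with
    | nil => exact fun g hg => hg
    | cons a q ih =>
      intro g hg
      refine ih _ fun x b => ?_
      by_cases ha : a.1 = i
      · subst ha
        simp
      · rw [Function.update_comm (Ne.symm ha), hg]
  induction p generalizing f with
  | nil => simp at hi
  | cons a p ih =>
    rcases List.mem_cons.1 hi with h | h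
    · refine aux p _ (fun x b => ?_) x b
      subst h
      simp
    · exact ih _ h

/-- The mean over a random walk to a leaf. -/
theorem sum_leaves_expect (T : PTree n) (G : Cube n → ℝ) :
    ∑ p ∈ leaves T, (2 : ℝ)⁻¹ ^ p.length * expect (restrict G p) = expect G := by
  induction T generalizing G with
  | leaf a => simp [leaves, restrict]
  | node i lo hi h1 h2 =>
    rw [sum_leaves_node, expect_update G i, ← h1, ← h2, add_div, Finset.sum_div, Finset.sum_div]
    congr 1 <;> refine Finset.sum_congr rfl fun p _ => ?_ <;>
      rw [List.length_cons, pow_succ, restrict] <;> ring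

theorem sum_leaves_pow (T : PTree n) : ∑ p ∈ leaves T, (2 : ℝ)⁻¹ ^ p.length = 1 := by
  induction T with
  | leaf a => simp [leaves]
  | node i lo hi h1 h2 =>
    rw [sum_leaves_node]
    simp only [List.length_cons, pow_succ, ← Finset.sum_mul, h1, h2]
    norm_num

/-- The subtree of a decision tree that computes a subfunction. -/
def DTree.fixPath {α : Type} (T : DTree n α) : Path n → DTree n α
  | [] => T
  | (i, b) :: p => (T.fixAttr i b).fixPath p

theorem DTree.size_fixPath_le {α : Type} (T : DTree n α) (p : Path n) :
    (T.fixPath p).size ≤ T.size := by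
  induction p generalizing T with
  | nil => exact le_rfl
  | cons a p ih => exact (ih _).trans (T.size_fixAttr_le _ _)

theorem DTree.eval_fixPath {α : Type} (T : DTree n α) (p : Path n) :
    (T.fixPath p).eval = restrict T.eval p := by
  induction p generalizing T with
  | nil => rfl
  | cons a p ih =>
    rw [DTree.fixPath, ih, restrict]
    congr 1
    exact funext fun x => T.eval_fixAttr _ _ x

theorem sum_leaves_dist (T : PTree n) (f g : Cube n → ℤˣ) :
    ∑ p ∈ leaves T, (2 : ℝ)⁻¹ ^ p.length * dist (restrict f p) (restrict g p) = dist f g := by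
  rw [dist, ← sum_leaves_expect T]
  refine Finset.sum_congr rfl fun p hp => ?_
  clear hp
  rw [dist]
  congr 2
  induction p generalizing f g with
  | nil => rfl
  | cons a p ih => exact ih _ _

/-- The indicator function of the points that follow a path. -/
def pathInd (p : Path n) (x : Cube n) : ℝ := (p.map fun a => if x a.1 = a.2 then (1 : ℝ) else 0).prod

theorem pathInd_cons (i : Fin n) (b : ℤˣ) (p : Path n) (x : Cube n) :
    pathInd ((i, b) :: p) x = (if x i = b then 1 else 0) * pathInd p x := by
  simp [pathInd]

theorem pathInd_append (p q : Path n) (x : Cube n) :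
    pathInd (p ++ q) x = pathInd p x * pathInd q x := by
  simp [pathInd]

theorem pathInd_nonneg (p : Path n) (x : Cube n) : 0 ≤ pathInd p x := by
  refine List.prod_nonneg fun a ha => ?_
  obtain ⟨c, _, rfl⟩ := List.mem_map.1 ha
  split_ifs <;> norm_num

theorem pathInd_eq_zero {p : Path n} {x : Cube n} {i : Fin n} {b : ℤˣ} (h : (i, b) ∈ p)
    (hx : x i ≠ b) : pathInd p x = 0 :=
  List.prod_eq_zero (List.mem_map.2 ⟨_, h, if_neg hx⟩)

theorem pathInd_update {p : Path n} {i : Fin n} (hi : i ∉ p.map Prod.fst) (x : Cube n) (b : ℤˣ) :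
    pathInd p (Function.update x i b) = pathInd p x := by
  unfold pathInd
  congr 1
  refine List.map_congr_left fun a ha => ?_
  rw [Function.update_of_ne]
  rintro rfl
  exact hi (List.mem_map_of_mem ha)

theorem expect_ite_mul (i : Fin n) (b : ℤˣ) (G : Cube n → ℝ) :
    expect (fun x => (if x i = b then 1 else 0) * G x) =
      2⁻¹ * expect fun x => G (Function.update x i b) := by
  rw [expect_update _ i]
  simp only [Function.update_self]
  rcases unit_cases b with rfl | rfl
  · have : (1 : ℤˣ) ≠ -1 := by decide
    simp [this, expect_const]
    ring
  · have : (-1 : ℤˣ) ≠ 1 := by decide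
    simp [this, expect_const]
    ring

theorem expect_pathInd_cons {i : Fin n} (b : ℤˣ) {p : Path n} (hi : i ∉ p.map Prod.fst) :
    expect (pathInd ((i, b) :: p)) = 2⁻¹ * expect (pathInd p) := by
  rw [show pathInd ((i, b) :: p) = fun x => (if x i = b then 1 else 0) * pathInd p x from
    funext fun x => pathInd_cons i b p x, expect_ite_mul]
  simp only [pathInd_update hi]

/-- Conditioned on following the path `p`, a uniform point is a uniform point with the answers of
`p` put in. -/
theorem expect_pathInd_mul (p : Path n) (F : Cube n → ℝ) :
    expect (fun x => pathInd p x * F x) = expect (pathInd p) * expect (restrict F p) := by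
  induction p generalizing F with
  | nil =>
    have : expect (pathInd ([] : Path n)) = 1 := expect_const 1
    rw [this]
    simp [pathInd, restrict]
  | cons a p ih =>
    obtain ⟨i, b⟩ := a
    rw [restrict]
    simp only [pathInd_cons, mul_assoc]
    -- A repeated attribute is either answered consistently, and its second test is redundant, or
    -- the path is contradictory and both sides vanish. A fresh attribute halves the probability.
    by_cases hi : i ∈ p.map Prod.fst
    · obtain ⟨⟨j, c⟩, hc, rfl⟩ := List.mem_map.1 hi
      dsimp only
      by_cases hcb : c = b
      · subst hcb
        have e1 : ∀ x, (if x j = c then 1 else 0) * (pathInd p x * F x) =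
            pathInd p x * F (Function.update x j c) := by
          intro x
          by_cases hx : x j = c
          · rw [if_pos hx, one_mul, ← hx, Function.update_eq_self]
          · rw [if_neg hx, pathInd_eq_zero hc hx, zero_mul, zero_mul]
        have e2 : pathInd ((j, c) :: p) = pathInd p := by
          funext x
          rw [pathInd_cons]
          by_cases hx : x j = c
          · rw [if_pos hx, one_mul]
          · rw [pathInd_eq_zero hc hx, mul_zero]
        simp only [e1, e2]
        exact ih _
      · have e1 : ∀ x, (if x j = b then (1 : ℝ) else 0) * pathInd p x = 0 := by
          intro x
          by_cases hx : x j = b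
          · rw [pathInd_eq_zero hc (by rw [hx]; exact Ne.symm hcb), mul_zero]
          · rw [if_neg hx, zero_mul]
        have e2 : pathInd ((j, b) :: p) = fun _ => 0 := by
          funext x
          rw [pathInd_cons, e1]
        simp only [← mul_assoc, e1, e2, zero_mul, expect_const]
    · rw [expect_pathInd_cons b hi, expect_ite_mul, mul_assoc, ← ih]
      simp only [pathInd_update hi]

theorem expect_pathInd {p : Path n} (hp : (p.map Prod.fst).Nodup) :
    expect (pathInd p) = 2⁻¹ ^ p.length := by
  induction p with
  | nil => exact expect_const 1
  | cons a p ih =>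
    obtain ⟨h1, h2⟩ := List.nodup_cons.1 hp
    rw [expect_pathInd_cons _ h1, ih h2, List.length_cons, pow_succ']

end Leaves

/-! ### The error of a completed tree -/

section Complete

variable {n : ℕ}

/-- The label that the completion gives to a leaf. -/
def leafLabel (f : Cube n → ℤˣ) (p : Path n) : ℤˣ :=
  if 0 ≤ fourierCoeff (restrict (toReal f) p) ∅ then 1 else -1

/-- The advantage of the best label at the leaf `p` over a random label. -/
def advantage (f : Cube n → ℤˣ) (p : Path n) : ℝ :=
  |expect fun x => pathInd p x * toReal f x|

theorem size_complete (charge : ℕ → ℕ) (f : Cube n → ℤˣ) (p : Path n) (T : PTree n) :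
    (complete charge f p T).val.size = T.size := by
  induction T generalizing p with
  | leaf a => rfl
  | node i lo hi h1 h2 =>
    change (complete charge f _ lo).val.size + (complete charge f _ hi).val.size = _
    rw [h1, h2, DTree.size]

theorem eval_complete (charge : ℕ → ℕ) (f : Cube n → ℤˣ) (p : Path n) (T : PTree n) (x : Cube n) :
    toReal (complete charge f p T).val.eval x =
      ∑ q ∈ leaves T, pathInd q x * ((leafLabel f (p ++ q) : ℤ) : ℝ) := by
  induction T generalizing p with
  | leaf a =>
    simp [leaves, pathInd]
    rfl
  | node i lo hi h1 h2 =>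
    have e : toReal (complete charge f p (.node i lo hi)).val.eval x = if x i = -1 then
        toReal (complete charge f (p ++ [(i, -1)]) lo).val.eval x else
        toReal (complete charge f (p ++ [(i, 1)]) hi).val.eval x := by
      change (((if x i = -1 then (complete charge f (p ++ [(i, -1)]) lo).val.eval x else
        (complete charge f (p ++ [(i, 1)]) hi).val.eval x : ℤˣ) : ℤ) : ℝ) = _
      split_ifs <;> rfl
    rw [e, h1, h2, sum_leaves_node]
    simp only [pathInd_cons, List.append_assoc, List.singleton_append]
    have h3 : (1 : ℤˣ) ≠ -1 := by decide
    rcases unit_cases (x i) with h | h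
    · simp [h, h3.symm]
    · simp [h, h3]

/-- Labelling by the sign of the mean turns each leaf's correlation with f into its absolute value.
The form with `advantage` also covers trees that repeat attributes, where 2^{-depth} need not be the
probability of a leaf. -/
theorem error_complete (charge : ℕ → ℕ) (f : Cube n → ℤˣ) (T : PTree n) :
    error f (complete charge f [] T).val = (1 - ∑ p ∈ leaves T, advantage f p) / 2 := by
  rw [error_eq_dist, dist_eq_expect_mul]
  simp only [eval_complete, Finset.mul_sum, expect_sum, List.nil_append]
  congr 2
  refine Finset.sum_congr rfl fun p _ => ?_
  have e : (fun x => toReal f x * (pathInd p x * ((leafLabel f p : ℤ) : ℝ))) =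
      fun x => ((leafLabel f p : ℤ) : ℝ) * (pathInd p x * toReal f x) := by
    funext x
    ring
  rw [e, expect_const_mul, advantage, expect_pathInd_mul, abs_mul,
    abs_of_nonneg (expect_nonneg (pathInd_nonneg p)), leafLabel, fourierCoeff_empty]
  split_ifs with h
  · rw [abs_of_nonneg h]
    simp
  · rw [abs_of_neg (not_le.1 h)]
    simp

/-- The triangle inequality for the correlations at the two children. Attributes may repeat, as they
can after the good round. -/
theorem error_complete_split_le (charge : ℕ → ℕ) (f : Cube n → ℤˣ) (i : Fin n) {T : PTree n}
    {p : Path n} (hp : p ∈ leaves T) :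
    error f (complete charge f [] (split i T p)).val ≤ error f (complete charge f [] T).val := by
  rw [error_complete, error_complete, sum_leaves_split i hp]
  have : advantage f p ≤ advantage f (p ++ [(i, -1)]) + advantage f (p ++ [(i, 1)]) := by
    unfold advantage
    refine le_trans (le_of_eq ?_) (abs_add_le _ _)
    rw [← expect_add]
    congr 2
    funext x
    have h3 : (1 : ℤˣ) ≠ -1 := by decide
    rw [pathInd_append, pathInd_append, pathInd_cons, pathInd_cons]
    rcases unit_cases (x i) with h | h
    · simp [h, h3.symm, pathInd]
    · simp [h, h3, pathInd]
  linarith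

theorem error_complete_of_nodup (charge : ℕ → ℕ) (f : Cube n → ℤˣ) {T : PTree n}
    (hT : ∀ p ∈ leaves T, (p.map Prod.fst).Nodup) :
    error f (complete charge f [] T).val =
      ∑ p ∈ leaves T, (2 : ℝ)⁻¹ ^ p.length * ((1 - |expect (toReal (restrict f p))|) / 2) := by
  have h : ∑ p ∈ leaves T, advantage f p =
      ∑ p ∈ leaves T, (2 : ℝ)⁻¹ ^ p.length * |expect (toReal (restrict f p))| := by
    refine Finset.sum_congr rfl fun p hp => ?_
    rw [advantage, expect_pathInd_mul, abs_mul, abs_of_nonneg (expect_nonneg (pathInd_nonneg p)),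
      expect_pathInd (hT p hp), restrict_toReal]
  rw [error_complete, h]
  conv_lhs => rw [← sum_leaves_pow T]
  rw [← Finset.sum_sub_distrib, Finset.sum_div]
  exact Finset.sum_congr rfl fun p _ => by ring

end Complete

/-! ### The rounds of the algorithm -/

section Rounds

variable {n : ℕ}

theorem maxLoop_spec {α β : Type} {tie : Finset α → α} (htie : ∀ s, s.Nonempty → tie s ∈ s)
    {s : Finset α} (hs : s.Nonempty) (g : α → Timed (β × ℝ)) :
    ∃ a ∈ s, (maxLoop tie s g).val = (g a).val ∧ ∀ b ∈ s, (g b).val.2 ≤ (g a).val.2 := by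
  obtain ⟨m, hm, hmax⟩ := Finset.exists_max_image s (fun a => (g a).val.2) hs
  have hne : (s.filter fun a => ∀ b ∈ s, (g b).val.2 ≤ (g a).val.2).Nonempty :=
    ⟨m, Finset.mem_filter.2 ⟨hm, hmax⟩⟩
  have := Finset.mem_filter.1 (htie _ hne)
  exact ⟨_, this.1, rfl, this.2⟩

/-- The score of the attribute `i` at the leaf `p`. -/
def score (f : Cube n → ℤˣ) (δ d : ℝ) (p : Path n) (i : Fin n) : ℝ :=
  2⁻¹ ^ p.length * noisyInfluence δ d (restrict (toReal f) p) i

/-- The tree after one round. -/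
def nextTree (f : Cube n → ℤˣ) (tie : TieBreak n) (δ d : ℝ) (T : PTree n) : PTree n :=
  (round (fun _ => 0) f tie δ d T).val

/-- The charge enters the time only, so the trees are iterates of a single map, defined with charge
zero. -/
theorem grow_val (charge : ℕ → ℕ) (f : Cube n → ℤˣ) (tie : TieBreak n) (δ d : ℝ) (k : ℕ)
    (T : PTree n) : (grow charge f tie δ d k T).val = (nextTree f tie δ d)^[k] T := by
  induction k generalizing T with
  | zero => rfl
  | succ k ih => exact ih _

/-- The tree after `k` rounds. -/
def treeAfter (f : Cube n → ℤˣ) (tie : TieBreak n) (δ d : ℝ) (k : ℕ) : PTree n :=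
  (nextTree f tie δ d)^[k] (.leaf ())

theorem treeAfter_succ (f : Cube n → ℤˣ) (tie : TieBreak n) (δ d : ℝ) (k : ℕ) :
    treeAfter f tie δ d (k + 1) = nextTree f tie δ d (treeAfter f tie δ d k) :=
  Function.iterate_succ_apply' _ _ _

theorem val_buildStabilizingDT (charge : ℕ → ℕ → ℕ) (f : Cube n → ℤˣ) (tie : TieBreak n) (t : ℕ)
    (δ ε : ℝ) : (buildStabilizingDT charge f tie t δ ε).val =
      (complete (charge ⌊Real.logb 2 (1 / ε) / δ⌋₊) f []
        (treeAfter f tie δ (Real.logb 2 (1 / ε) / δ) (t - 1))).val := by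
  rw [treeAfter, ← grow_val (charge ⌊Real.logb 2 (1 / ε) / δ⌋₊)]
  rfl

variable [NeZero n]

theorem scoreLeaf_spec (charge : ℕ → ℕ) (f : Cube n → ℤˣ) (tie : TieBreak n) (δ d : ℝ)
    (T : PTree n) (p : Path n) :
    (scoreLeaf charge f tie δ d T p).val.2 =
      score f δ d p (scoreLeaf charge f tie δ d T p).val.1 ∧
    ∀ j, score f δ d p j ≤ (scoreLeaf charge f tie δ d T p).val.2 := by
  obtain ⟨i, _, h1, h2⟩ := maxLoop_spec (tie.attr_mem T p) (Finset.univ_nonempty (α := Fin n))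
    fun i => (do
      let v ← influence charge f δ d p i
      return (i, v) : Timed (Fin n × ℝ))
  have e : (scoreLeaf charge f tie δ d T p).val = (i, score f δ d p i) := by
    change ((maxLoop (tie.attr T p) Finset.univ _).val.1,
      (2 : ℝ)⁻¹ ^ p.length * (maxLoop (tie.attr T p) Finset.univ _).val.2) = _
    rw [h1]
    rfl
  rw [e]
  exact ⟨rfl, fun j => mul_le_mul_of_nonneg_left (h2 j (Finset.mem_univ j)) (by positivity)⟩

/-- A round splits a leaf of highest score with its attribute. -/
theorem exists_nextTree_eq (f : Cube n → ℤˣ) (tie : TieBreak n) (δ d : ℝ) (T : PTree n) :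
    ∃ p ∈ leaves T, ∃ i, nextTree f tie δ d T = split i T p ∧
      ∀ q ∈ leaves T, ∀ j, score f δ d q j ≤ score f δ d p i := by
  obtain ⟨p, hp, h1, h2⟩ := maxLoop_spec (tie.leaf_mem T) (leaves_nonempty T)
    fun p => (do
      let q ← scoreLeaf (fun _ => 0) f tie δ d T p
      return ((p, q.1), q.2) : Timed ((Path n × Fin n) × ℝ))
  refine ⟨p, hp, (scoreLeaf (fun _ => 0) f tie δ d T p).val.1, ?_, fun q hq j => ?_⟩
  · have e : nextTree f tie δ d T = (fun r : (Path n × Fin n) × ℝ => split r.1.2 T r.1.1)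
        (maxLoop (tie.leaf T) (leaves T) fun p => (do
          let q ← scoreLeaf (fun _ => 0) f tie δ d T p
          return ((p, q.1), q.2) : Timed ((Path n × Fin n) × ℝ))).val := rfl
    rw [e, h1]
    rfl
  · rw [← (scoreLeaf_spec (fun _ => 0) f tie δ d T p).1]
    exact ((scoreLeaf_spec (fun _ => 0) f tie δ d T q).2 j).trans (h2 q hq)

theorem size_nextTree (f : Cube n → ℤˣ) (tie : TieBreak n) (δ d : ℝ) (T : PTree n) :
    (nextTree f tie δ d T).size = T.size + 1 := by
  obtain ⟨p, hp, i, h, -⟩ := exists_nextTree_eq f tie δ d T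
  rw [h, size_split i hp]

theorem error_nextTree_le (charge : ℕ → ℕ) (f : Cube n → ℤˣ) (tie : TieBreak n) (δ d : ℝ)
    (T : PTree n) :
    error f (complete charge f [] (nextTree f tie δ d T)).val ≤
      error f (complete charge f [] T).val := by
  obtain ⟨p, hp, i, h, -⟩ := exists_nextTree_eq f tie δ d T
  rw [h]
  exact error_complete_split_le charge f i hp

theorem size_treeAfter (f : Cube n → ℤˣ) (tie : TieBreak n) (δ d : ℝ) (k : ℕ) :
    (treeAfter f tie δ d k).size = k + 1 := by
  induction k with
  | zero => rfl
  | succ k ih => rw [treeAfter_succ, size_nextTree, ih]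

theorem error_treeAfter_antitone (charge : ℕ → ℕ) (f : Cube n → ℤˣ) (tie : TieBreak n) (δ d : ℝ) :
    Antitone fun k => error f (complete charge f [] (treeAfter f tie δ d k)).val := by
  refine antitone_nat_of_succ_le fun k => ?_
  rw [treeAfter_succ]
  exact error_nextTree_le charge f tie δ d _

end Rounds

/-! ### The potential -/

section Potential

variable {n : ℕ}

/-- The noise stability of `g`. -/
def stability (δ : ℝ) (g : Cube n → ℝ) : ℝ := ∑ S, (1 - δ) ^ S.card * fourierCoeff g S ^ 2

theorem stability_nonneg {δ : ℝ} (hδ : δ ≤ 1) (g : Cube n → ℝ) : 0 ≤ stability δ g :=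
  Finset.sum_nonneg fun S _ => mul_nonneg (pow_nonneg (by linarith) _) (sq_nonneg _)

theorem stability_toReal_le {δ : ℝ} (h0 : 0 ≤ δ) (h1 : δ ≤ 1) (g : Cube n → ℤˣ) :
    stability δ (toReal g) ≤ 1 := by
  rw [← sum_fourierCoeff_toReal_sq g]
  exact Finset.sum_le_sum fun S _ =>
    mul_le_of_le_one_left (sq_nonneg _) (pow_le_one₀ (by linarith) (by linarith))

theorem noisyInfluence_nonneg {δ : ℝ} (hδ : δ ≤ 1) (d : ℝ) (g : Cube n → ℝ) (i : Fin n) :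
    0 ≤ noisyInfluence δ d g i :=
  Finset.sum_nonneg fun S _ => mul_nonneg (pow_nonneg (by linarith) _) (sq_nonneg _)

theorem noisyInfluence_le_one {δ : ℝ} (h0 : 0 ≤ δ) (h1 : δ ≤ 1) (d : ℝ) (g : Cube n → ℤˣ)
    (i : Fin n) : noisyInfluence δ d (toReal g) i ≤ 1 :=
  (Finset.sum_le_sum_of_subset_of_nonneg (Finset.subset_univ _) fun S _ _ =>
    mul_nonneg (pow_nonneg (by linarith) _) (sq_nonneg _)).trans (stability_toReal_le h0 h1 g)

theorem noisyInfluence_eq_zero (δ d : ℝ) {g : Cube n → ℝ} {i : Fin n}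
    (hg : ∀ x b, g (Function.update x i b) = g x) : noisyInfluence δ d g i = 0 := by
  refine Finset.sum_eq_zero fun S hS => ?_
  rw [fourierCoeff_eq_zero hg (Finset.mem_filter.1 hS).2.1]
  simp

/-- Fixing an attribute of large noisy influence at random raises the noise stability. -/
theorem stability_add_le {δ : ℝ} (h0 : 0 ≤ δ) (h1 : δ ≤ 1) (d : ℝ) (g : Cube n → ℝ) (i : Fin n) :
    stability δ g + δ * noisyInfluence δ d g i ≤
      (stability δ (fun x => g (Function.update x i (-1))) +
        stability δ (fun x => g (Function.update x i 1))) / 2 := by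
  unfold stability
  rw [sum_weight_update g i fun S => (1 - δ) ^ S.card, noisyInfluence, setsAt, Finset.sum_filter,
    Finset.mul_sum, ← Finset.sum_add_distrib]
  refine Finset.sum_le_sum fun S _ => ?_
  have hw : 0 ≤ (1 - δ) ^ (S.erase i).card := pow_nonneg (by linarith) _
  have hsq := sq_nonneg (fourierCoeff g S)
  by_cases hi : i ∈ S
  -- A set S containing `i` gains (1-δ)^{|S|-1} - (1-δ)^{|S|} = δ(1-δ)^{|S|-1}, at least δ times its
  -- term in the influence; sets above the cutoff only help.
  · have e : (1 - δ) ^ S.card = (1 - δ) ^ (S.erase i).card * (1 - δ) := by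
      rw [← Finset.card_erase_add_one hi, pow_succ]
    have h2 := mul_nonneg hw hsq
    rw [e]
    have h3 := mul_nonneg h0 h2
    have h4 := mul_nonneg h0 h3
    split_ifs <;> linarith
  · rw [if_neg (fun h => hi h.1), Finset.erase_eq_of_notMem hi]
    simp

/-- The average noise stability of the subfunctions at the leaves. -/
def potential (δ : ℝ) (f : Cube n → ℤˣ) (T : PTree n) : ℝ :=
  ∑ p ∈ leaves T, (2 : ℝ)⁻¹ ^ p.length * stability δ (restrict (toReal f) p)

theorem potential_nonneg {δ : ℝ} (h1 : δ ≤ 1) (f : Cube n → ℤˣ) (T : PTree n) :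
    0 ≤ potential δ f T :=
  Finset.sum_nonneg fun _ _ => mul_nonneg (by positivity) (stability_nonneg h1 _)

theorem potential_le_one {δ : ℝ} (h0 : 0 ≤ δ) (h1 : δ ≤ 1) (f : Cube n → ℤˣ) (T : PTree n) :
    potential δ f T ≤ 1 := by
  rw [← sum_leaves_pow T]
  refine Finset.sum_le_sum fun p _ => mul_le_of_le_one_right (by positivity) ?_
  rw [restrict_toReal]
  exact stability_toReal_le h0 h1 _

theorem potential_split {δ : ℝ} (h0 : 0 ≤ δ) (h1 : δ ≤ 1) (d : ℝ) (f : Cube n → ℤˣ) (i : Fin n)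
    {T : PTree n} {p : Path n} (hp : p ∈ leaves T) :
    potential δ f T + δ * score f δ d p i ≤ potential δ f (split i T p) := by
  unfold potential
  rw [sum_leaves_split i hp, List.length_append, List.length_append]
  have h := mul_le_mul_of_nonneg_left (stability_add_le h0 h1 d (restrict (toReal f) p) i)
    (by positivity : (0 : ℝ) ≤ 2⁻¹ ^ p.length)
  simp only [restrict_append, restrict, List.length_singleton, pow_succ, score]
  linarith

/-- The average over the leaves of the largest noisy influence. -/
def averageMaxInfluence (f : Cube n → ℤˣ) (δ d : ℝ) (T : PTree n) : ℝ :=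
  ∑ p ∈ leaves T, (2 : ℝ)⁻¹ ^ p.length * ⨆ i, noisyInfluence δ d (restrict (toReal f) p) i

variable [NeZero n]

/-- A leaf that is split has a score of at least the average. -/
theorem exists_nextTree_eq_of_lt (f : Cube n → ℤˣ) (tie : TieBreak n) {δ d κ : ℝ} {T : PTree n}
    (hT : κ < averageMaxInfluence f δ d T) :
    ∃ p ∈ leaves T, ∃ i, nextTree f tie δ d T = split i T p ∧ κ / T.size ≤ score f δ d p i := by
  obtain ⟨p, hp, i, h1, h2⟩ := exists_nextTree_eq f tie δ d T
  refine ⟨p, hp, i, h1, ?_⟩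
  have hs : (0 : ℝ) < T.size := Nat.cast_pos.2 T.size_pos
  rw [div_le_iff₀' hs]
  refine hT.le.trans ?_
  rw [← card_leaves, ← nsmul_eq_mul]
  -- The leaf weight times the largest influence is the leaf's best score, and none exceeds the
  -- score of the split leaf.
  refine Finset.sum_le_card_nsmul _ _ _ fun q hq => ?_
  obtain ⟨j, hj⟩ := exists_eq_ciSup_of_finite (f := noisyInfluence δ d (restrict (toReal f) q))
  rw [← hj]
  exact h2 q hq j

/-- The tree after j rounds has j + 1 leaves, so round j contributes at least δκ/(j + 1). -/
theorem potential_treeAfter_ge (f : Cube n → ℤˣ) (tie : TieBreak n) {δ d κ : ℝ} (h0 : 0 ≤ δ)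
    (h1 : δ ≤ 1) {k : ℕ}
    (hk : ∀ j < k, κ < averageMaxInfluence f δ d (treeAfter f tie δ d j)) :
    δ * κ * harmonic k ≤ potential δ f (treeAfter f tie δ d k) := by
  induction k with
  | zero => simpa using potential_nonneg h1 f _
  | succ k ih =>
    obtain ⟨p, hp, i, h2, h3⟩ := exists_nextTree_eq_of_lt f tie (hk k k.lt_succ_self)
    have h4 := potential_split h0 h1 d f i hp
    rw [treeAfter_succ, h2]
    rw [size_treeAfter] at h3
    have h5 := ih fun j hj => hk j (hj.trans k.lt_succ_self)
    have h6 := mul_le_mul_of_nonneg_left h3 h0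
    rw [harmonic_succ]
    push_cast at h6 ⊢
    rw [mul_add]
    have h7 : δ * (κ / (k + 1)) = δ * κ * ((k : ℝ) + 1)⁻¹ := by ring
    linarith

/-- The first time at which all leaves have small influences on average. -/
theorem exists_averageMaxInfluence_le (f : Cube n → ℤˣ) (tie : TieBreak n) {δ d κ : ℝ} (h0 : 0 < δ)
    (h1 : δ ≤ 1) (hκ : 0 < κ) {t : ℕ} (ht : Real.exp (1 / (δ * κ)) < t) :
    ∃ k < t, averageMaxInfluence f δ d (treeAfter f tie δ d k) ≤ κ ∧
      ∀ j < k, κ < averageMaxInfluence f δ d (treeAfter f tie δ d j) := by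
  have hex : ∃ k, k < t ∧ averageMaxInfluence f δ d (treeAfter f tie δ d k) ≤ κ := by
    by_contra! H
    have h2 := (potential_treeAfter_ge f tie h0.le h1 H).trans (potential_le_one h0.le h1 f _)
    have h3 := log_add_one_le_harmonic t
    -- If the average stayed above κ for t rounds, then log(t + 1) ≤ H_t ≤ 1/(δκ) < log(t + 1).
    have hδκ : 0 < δ * κ := mul_pos h0 hκ
    rw [mul_comm, ← le_div_iff₀ hδκ] at h2
    have h4 : Real.exp (1 / (δ * κ)) < ((t + 1 : ℕ) : ℝ) := by
      push_cast
      linarith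
    rw [← Real.lt_log_iff_exp_lt (by positivity)] at h4
    linarith
  classical
  refine ⟨Nat.find hex, (Nat.find_spec hex).1, (Nat.find_spec hex).2, fun j hj => ?_⟩
  by_contra! H
  exact Nat.find_min hex hj ⟨hj.trans (Nat.find_spec hex).1, H⟩

/-- As long as the influences are large on average, no attribute is queried twice on a path and
the leaves are not deep. -/
theorem leaves_treeAfter (f : Cube n → ℤˣ) (tie : TieBreak n) {δ d κ : ℝ} (h0 : 0 ≤ δ)
    (h1 : δ ≤ 1) (hκ : 0 < κ) (hκ1 : κ ≤ 1) {k : ℕ}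
    (hk : ∀ j < k, κ < averageMaxInfluence f δ d (treeAfter f tie δ d j)) :
    ∀ p ∈ leaves (treeAfter f tie δ d k),
      (p.map Prod.fst).Nodup ∧ κ * 2 ^ p.length ≤ 2 * (k + 1) := by
  induction k with
  | zero =>
    intro p hp
    obtain rfl : p = [] := by simpa [treeAfter, leaves] using hp
    simp
    linarith
  | succ k ih =>
    intro q hq
    obtain ⟨p, hp, i, h2, h3⟩ := exists_nextTree_eq_of_lt f tie (hk k k.lt_succ_self)
    rw [treeAfter_succ, h2] at hq
    have ih' := ih fun j hj => hk j (hj.trans k.lt_succ_self)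
    push_cast
    rcases mem_leaves_split hp hq with hq' | ⟨b, rfl⟩
    · obtain ⟨h4, h5⟩ := ih' q hq'
      exact ⟨h4, by linarith⟩
    · have hsz : (0 : ℝ) < ((treeAfter f tie δ d k).size : ℝ) :=
        Nat.cast_pos.2 (DTree.size_pos _)
      -- A positive score forces a fresh attribute, as a repeated one has influence zero.
      have hpos : 0 < score f δ d p i := lt_of_lt_of_le (by positivity) h3
      constructor
      · rw [List.map_append, List.nodup_append]
        refine ⟨(ih' p hp).1, by simp, ?_⟩
        simp only [List.map_cons, List.map_nil, List.mem_singleton]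
        rintro a ha c rfl hac
        rw [hac] at ha
        rw [score, noisyInfluence_eq_zero δ d fun x b => restrict_update_of_mem _ ha x b,
          mul_zero] at hpos
        exact hpos.false
      -- From κ/(k + 1) ≤ score ≤ 2^{-|p|}; the children are one level deeper, which is the factor 2
      -- in the bound.
      · have h4 : score f δ d p i ≤ 2⁻¹ ^ p.length := by
          refine mul_le_of_le_one_right (by positivity) ?_
          rw [restrict_toReal]
          exact noisyInfluence_le_one h0 h1 d _ i
        have h5 := h3.trans h4
        rw [inv_pow, div_le_iff₀ hsz, inv_mul_eq_div, le_div_iff₀ (by positivity),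
          size_treeAfter] at h5
        rw [List.length_append, List.length_singleton, pow_succ]
        push_cast at h5
        linarith

end Potential

/-! ### The error of the tree with small influences -/

section Error

variable {n : ℕ}

theorem error_complete_le (charge : ℕ → ℕ) (f : Cube n → ℤˣ) {T : PTree n}
    (hT : ∀ p ∈ leaves T, (p.map Prod.fst).Nodup) {s D : ℕ} (hs : 2 ≤ s)
    {ε δ d : ℝ} (hε0 : 0 < ε) (hε : ε < 1 / 2) (hδ : δ = ε / Real.logb 2 s) (hδ1 : δ ≤ 1)
    (hd : 1 ≤ δ * d) (hD : 1000 * s / ε ≤ 2 ^ D)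
    (hκ : D * Real.logb 2 s * averageMaxInfluence f δ d T ≤ ε / 1000) :
    error f (complete charge f [] T).val ≤ 73 * opt f s + ε := by
  have key : ∀ U : DTree n ℤˣ, U.size ≤ s →
      error f (complete charge f [] T).val ≤ 73 * error f U + ε := by
    intro U hU
    rw [error_complete_of_nodup charge f hT, error_eq_dist f U]
    have h1 : ∀ p ∈ leaves T,
        (2 : ℝ)⁻¹ ^ p.length * ((1 - |expect (toReal (restrict f p))|) / 2) ≤
        92 / 100 * ε * 2⁻¹ ^ p.length +
        73 * (2⁻¹ ^ p.length * dist (restrict f p) (restrict U.eval p)) +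
        36 * (D * Real.logb 2 s) *
          (2⁻¹ ^ p.length * ⨆ i, noisyInfluence δ d (restrict (toReal f) p) i) := by
      intro p _
      have h2 := bias_le (g := restrict f p) (T := U.fixPath p) hs ((U.size_fixPath_le p).trans hU)
        hε0 hε hδ hd hD (M := ⨆ i, noisyInfluence δ d (restrict (toReal f) p) i)
        (Real.iSup_nonneg fun i => noisyInfluence_nonneg hδ1 _ _ _) (fun i => by
          rw [← restrict_toReal]
          exact le_ciSup (Set.finite_range _).bddAbove i)
      rw [DTree.eval_fixPath] at h2
      have h3 := mul_le_mul_of_nonneg_left h2 (by positivity : (0 : ℝ) ≤ 2⁻¹ ^ p.length)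
      linarith
    have h2 := Finset.sum_le_sum h1
    rw [Finset.sum_add_distrib, Finset.sum_add_distrib, ← Finset.mul_sum, ← Finset.mul_sum,
      ← Finset.mul_sum, sum_leaves_pow, sum_leaves_dist] at h2
    change _ ≤ _ + 36 * (D * Real.logb 2 s) * averageMaxInfluence f δ d T at h2
    -- The influence term contributes 36ε/1000, and 0.92 + 0.036 < 1.
    linarith
  have h : (error f (complete charge f [] T).val - ε) / 73 ≤ opt f s := by
    refine le_csInf ⟨_, ⟨.leaf 1, ?_, rfl⟩⟩ ?_
    · change 1 ≤ s
      omega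
    · rintro _ ⟨U, hU, rfl⟩
      rw [div_le_iff₀ (by norm_num)]
      linarith [key U hU]
  linarith

end Error

/-! ### The running time -/

section Time

variable {n : ℕ}

theorem card_setsAt_le {d : ℝ} (hd : 0 ≤ d) (i : Fin n) :
    (setsAt d i).card ≤ (n + 1) ^ ⌊d⌋₊ := by
  have hsub : setsAt d i ⊆ Finset.univ.image
      fun v : Fin ⌊d⌋₊ → Option (Fin n) => (Finset.univ.image v).eraseNone := by
    intro S hS
    have hc : S.card ≤ ⌊d⌋₊ := (Nat.le_floor_iff hd).2 (Finset.mem_filter.1 hS).2.2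
    -- A set of size at most ⌊d⌋ is enumerated in the first slots, and the remaining slots hold
    -- `none`.
    refine Finset.mem_image.2 ⟨fun k => if h : k.1 < S.card then some (S.equivFin.symm ⟨k, h⟩).1
      else none, Finset.mem_univ _, ?_⟩
    ext j
    simp only [Finset.mem_eraseNone, Finset.mem_image, Finset.mem_univ, true_and]
    constructor
    · rintro ⟨k, hk⟩
      split_ifs at hk
      rw [← Option.some.inj hk]
      exact Subtype.property _
    · intro hj
      refine ⟨⟨S.equivFin ⟨j, hj⟩, (S.equivFin ⟨j, hj⟩).2.trans_le hc⟩, ?_⟩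
      simp
  refine (Finset.card_le_card hsub).trans (Finset.card_image_le.trans ?_)
  simp [Finset.card_univ]

theorem time_influence_le {charge : ℕ → ℕ} (f : Cube n → ℤˣ) (δ : ℝ) {d : ℝ} (hd : 0 ≤ d)
    {p : Path n} {B : ℕ} (hB : charge p.length ≤ B) (i : Fin n) :
    (influence charge f δ d p i).time ≤ (n + 1) ^ ⌊d⌋₊ * (B + 2 * n + 3) := by
  have e : (influence charge f δ d p i).time =
      ∑ S ∈ setsAt d i, (charge p.length + (2 * S.card + 2 + 0) + 1) := rfl
  rw [e]
  refine (Finset.sum_le_card_nsmul _ _ (B + 2 * n + 3) fun S _ => ?_).trans ?_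
  · have := card_finset_fin_le S
    omega
  · rw [smul_eq_mul]
    exact Nat.mul_le_mul_right _ (card_setsAt_le hd i)

theorem time_scoreLeaf_le {charge : ℕ → ℕ} (f : Cube n → ℤˣ) (tie : TieBreak n) (δ : ℝ) {d : ℝ}
    (hd : 0 ≤ d) (T : PTree n) {p : Path n} {B : ℕ} (hB : charge p.length ≤ B) :
    (scoreLeaf charge f tie δ d T p).time ≤
      n * ((n + 1) ^ ⌊d⌋₊ * (B + 2 * n + 3) + 1) + (p.length + 1) := by
  have e : (scoreLeaf charge f tie δ d T p).time =
      ∑ i : Fin n, ((influence charge f δ d p i).time + 0 + 1) + (p.length + 1 + 0) := rfl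
  rw [e]
  refine Nat.add_le_add_right ?_ _
  refine (Finset.sum_le_card_nsmul _ _ ((n + 1) ^ ⌊d⌋₊ * (B + 2 * n + 3) + 1) fun i _ => ?_).trans ?_
  · have := time_influence_le f δ hd hB i
    omega
  · simp

theorem time_round_le {charge : ℕ → ℕ} (f : Cube n → ℤˣ) (tie : TieBreak n) (δ : ℝ) {d : ℝ}
    (hd : 0 ≤ d) {T : PTree n} {B t : ℕ} (hB : ∀ p ∈ leaves T, charge p.length ≤ B)
    (ht : T.size ≤ t) : (round charge f tie δ d T).time ≤
      t * (n * ((n + 1) ^ ⌊d⌋₊ * (B + 2 * n + 3) + 1) + t + 1) + t := by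
  obtain ⟨p, hp, h1, -⟩ := maxLoop_spec (tie.leaf_mem T) (leaves_nonempty T)
    fun p => (do
      let q ← scoreLeaf charge f tie δ d T p
      return ((p, q.1), q.2) : Timed ((Path n × Fin n) × ℝ))
  have e : (round charge f tie δ d T).time =
      ∑ p ∈ leaves T, ((scoreLeaf charge f tie δ d T p).time + 0 + 1) +
      ((fun r : (Path n × Fin n) × ℝ => r.1.1.length)
        (maxLoop (tie.leaf T) (leaves T) fun p => (do
          let q ← scoreLeaf charge f tie δ d T p
          return ((p, q.1), q.2) : Timed ((Path n × Fin n) × ℝ))).val + 1 + 0) := rfl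
  rw [e, h1]
  refine Nat.add_le_add ?_ ((length_lt_size hp).trans_le ht)
  refine (Finset.sum_le_card_nsmul _ _
    (n * ((n + 1) ^ ⌊d⌋₊ * (B + 2 * n + 3) + 1) + t + 1) fun q hq => ?_).trans ?_
  · have h2 := time_scoreLeaf_le f tie δ hd T (hB q hq)
    have h3 := length_lt_size hq
    omega
  · rw [card_leaves, smul_eq_mul]
    exact Nat.mul_le_mul_right _ ht

theorem time_grow_le (charge : ℕ → ℕ) (f : Cube n → ℤˣ) (tie : TieBreak n) (δ d : ℝ) {R k : ℕ}
    {T : PTree n}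
    (hR : ∀ j < k, (round charge f tie δ d ((nextTree f tie δ d)^[j] T)).time ≤ R) :
    (grow charge f tie δ d k T).time ≤ k * (R + 1) + 1 := by
  induction k generalizing T with
  | zero => simp [grow, tick, bind, pure]
  | succ k ih =>
    have e : (grow charge f tie δ d (k + 1) T).time =
        1 + ((round charge f tie δ d T).time +
          (grow charge f tie δ d k (nextTree f tie δ d T)).time) := rfl
    have h1 := hR 0 k.succ_pos
    have h2 := ih (T := nextTree f tie δ d T) fun j hj => hR (j + 1) (Nat.succ_lt_succ hj)
    rw [Function.iterate_zero, id] at h1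
    rw [e, Nat.succ_mul]
    omega

/-- The extra 1 on the left makes the induction additive: it pays for the inner node joining two
subtrees. -/
theorem time_complete_le {charge : ℕ → ℕ} (f : Cube n → ℤˣ) {B : ℕ} (p : Path n) (T : PTree n)
    (hB : ∀ q ∈ leaves T, charge (p ++ q).length ≤ B) :
    (complete charge f p T).time + 1 ≤ T.size * (B + 2) := by
  induction T generalizing p with
  | leaf a =>
    have h := hB [] (by simp [leaves])
    rw [List.append_nil] at h
    have e : (complete charge f p (.leaf a)).time = charge p.length + (1 + 0) := rfl
    rw [e, DTree.size]
    omega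
  | node i lo hi h1 h2 =>
    have e : (complete charge f p (.node i lo hi)).time =
      1 + ((complete charge f (p ++ [(i, -1)]) lo).time +
        ((complete charge f (p ++ [(i, 1)]) hi).time + 0)) := rfl
    have h3 := h1 (p ++ [(i, -1)]) fun q hq => by
      rw [List.append_assoc]
      exact hB _ (mem_leaves_node.2 (.inl ⟨q, hq, rfl⟩))
    have h4 := h2 (p ++ [(i, 1)]) fun q hq => by
      rw [List.append_assoc]
      exact hB _ (mem_leaves_node.2 (.inr ⟨q, hq, rfl⟩))
    rw [e, DTree.size, Nat.add_mul]
    omega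

theorem time_buildStabilizingDT_le [NeZero n] {charge : ℕ → ℕ → ℕ} (f : Cube n → ℤˣ)
    (tie : TieBreak n) {t : ℕ} (ht : 1 ≤ t) {δ ε d : ℝ} (hd : Real.logb 2 (1 / ε) / δ = d)
    (hd0 : 0 ≤ d) {B : ℕ} (hB1 : 1 ≤ B)
    (hB : ∀ j < t, ∀ p ∈ leaves (treeAfter f tie δ d j), charge ⌊d⌋₊ p.length ≤ B) :
    (buildStabilizingDT charge f tie t δ ε).time ≤ 17 * (t * (n + 1) ^ (⌊d⌋₊ + 1)) ^ 3 * B := by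
  obtain ⟨k, rfl⟩ : ∃ k, t = k + 1 := ⟨t - 1, by omega⟩
  set Y := (n + 1) ^ (⌊d⌋₊ + 1) with hY
  set R := (k + 1) * (n * ((n + 1) ^ ⌊d⌋₊ * (B + 2 * n + 3) + 1) + (k + 1) + 1) + (k + 1) with hR
  have h1 : (grow (charge ⌊d⌋₊) f tie δ d k (.leaf ())).time ≤ k * (R + 1) + 1 := by
    refine time_grow_le _ f tie δ d fun j hj => ?_
    refine time_round_le f tie δ hd0 (hB j (hj.trans k.lt_succ_self)) ?_
    rw [← treeAfter, size_treeAfter]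
    omega
  have h2 : (complete (charge ⌊d⌋₊) f [] (treeAfter f tie δ d k)).time + 1 ≤ (k + 1) * (B + 2) := by
    rw [← size_treeAfter f tie δ d k]
    exact time_complete_le f [] _ (hB k k.lt_succ_self)
  have e : (buildStabilizingDT charge f tie (k + 1) δ ε).time =
      (grow (charge ⌊d⌋₊) f tie δ d k (.leaf ())).time +
        (complete (charge ⌊d⌋₊) f [] (treeAfter f tie δ d k)).time := by
    subst hd
    rw [treeAfter, ← grow_val (charge ⌊Real.logb 2 (1 / ε) / δ⌋₊)]
    rfl
  have hY1 : 1 ≤ Y := Nat.one_le_pow _ _ n.succ_pos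
  have hYn : n ≤ Y := n.le_succ.trans (Nat.le_self_pow (Nat.succ_ne_zero _) _)
  have hYD : (n + 1) ^ ⌊d⌋₊ ≤ Y := Nat.pow_le_pow_right n.succ_pos (Nat.le_succ _)
  have hYB : 1 ≤ Y * B := Nat.mul_pos hY1 hB1
  have h3 : B + 2 * n + 3 ≤ 6 * (Y * B) := by nlinarith
  have h4 : n * ((n + 1) ^ ⌊d⌋₊ * (B + 2 * n + 3) + 1) ≤ 7 * (Y ^ 3 * B) := by
    calc _ ≤ Y * (Y * (6 * (Y * B)) + 1) := by gcongr
      _ = 6 * (Y ^ 3 * B) + Y := by ring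
      _ ≤ 6 * (Y ^ 3 * B) + Y ^ 3 * B := by
          gcongr
          calc Y = Y ^ 1 * 1 := by ring
            _ ≤ Y ^ 3 * B := by gcongr; omega
      _ = _ := by ring
  set W := Y ^ 3 * B with hW
  have hW1 : 1 ≤ W := Nat.mul_pos (Nat.pow_pos hY1) hB1
  have hWB : B ≤ W := Nat.le_mul_of_pos_left _ (Nat.pow_pos hY1)
  set t := k + 1
  have h5 : R ≤ 10 * (t ^ 2 * W) := by
    have h6 : t ≤ t * W := Nat.le_mul_of_pos_right _ hW1
    calc R ≤ t * (7 * W + t * W + W) + t * (t * W) := by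
          rw [hR]
          gcongr
          nlinarith
      _ ≤ t * (7 * (t * W) + t * W + t * W) + t * (t * W) := by
          gcongr <;> exact Nat.le_mul_of_pos_left _ ht
      _ = _ := by ring
  rw [e]
  have h6 : k * (R + 1) + 1 ≤ t * (R + 1) := by
    have : t = k + 1 := rfl
    rw [this]
    nlinarith
  calc _ ≤ t * (R + 1) + t * (B + 2) := by omega
    _ ≤ t * (10 * (t ^ 2 * W) + t ^ 2 * W) + t * (t ^ 2 * W + 2 * (t ^ 2 * W)) := by
        have h7 : W ≤ t ^ 2 * W := Nat.le_mul_of_pos_left _ (Nat.pow_pos ht)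
        have h8 := hW1.trans h7
        gcongr
        · exact hWB.trans h7
        · omega
    _ = 14 * ((t * Y) ^ 3 * B) := by rw [hW]; ring
    _ ≤ 17 * ((t * Y) ^ 3 * B) := Nat.mul_le_mul_right _ (by norm_num)
    _ = _ := by ring

end Time

/-! ### The parameters -/

section Parameters

/-- The depth to which the comparison tree is followed. -/
def hybridDepth (s : ℕ) (ε : ℝ) : ℕ := ⌈Real.logb 2 (1000 * s / ε)⌉₊

/-- The size parameter of the algorithm. -/
def sizeParameter (s : ℕ) (ε : ℝ) : ℕ :=
  ⌊Real.exp (1000 * hybridDepth s ε * (Real.logb 2 s ^ 2 / ε ^ 2))⌋₊ + 1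

variable {s : ℕ} {ε : ℝ}

theorem one_le_logb_cast (hs : 2 ≤ s) : 1 ≤ Real.logb 2 s := by
  have hs' : (2 : ℝ) ≤ s := by exact_mod_cast hs
  rw [Real.le_logb_iff_rpow_le one_lt_two (by linarith)]
  simpa using hs'

theorem one_le_logb_inv (hε0 : 0 < ε) (hε : ε < 1 / 2) : 1 ≤ Real.logb 2 (1 / ε) := by
  rw [Real.le_logb_iff_rpow_le one_lt_two (by positivity), Real.rpow_one, le_div_iff₀ hε0]
  linarith

/-- Since log s ≥ 1, X = (log s)²/ε² is at least 1/ε², so log X absorbs log(1/ε) and is at least 2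
when ε < 1/2. -/
theorem two_mul_logb_inv_le (hs : 2 ≤ s) (hε0 : 0 < ε) :
    2 * Real.logb 2 (1 / ε) ≤ Real.logb 2 (Real.logb 2 s ^ 2 / ε ^ 2) := by
  have hl := one_le_logb_cast hs
  rw [← Real.logb_rpow_eq_mul_logb_of_pos (by positivity)]
  refine Real.logb_le_logb_of_le one_lt_two (by positivity) ?_
  rw [Real.rpow_two, div_pow, one_pow]
  gcongr
  exact one_le_pow₀ hl

theorem one_le_ratio (hs : 2 ≤ s) (hε0 : 0 < ε) (hε : ε < 1 / 2) :
    1 ≤ Real.logb 2 s / ε := by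
  have hl := one_le_logb_cast hs
  rw [le_div_iff₀ hε0]
  linarith

theorem le_two_pow_hybridDepth (hs : 2 ≤ s) (hε0 : 0 < ε) :
    1000 * s / ε ≤ 2 ^ hybridDepth s ε := by
  have hs' : (2 : ℝ) ≤ s := by exact_mod_cast hs
  have h := Nat.le_ceil (Real.logb 2 (1000 * s / ε))
  rw [Real.logb_le_iff_le_rpow one_lt_two (by positivity), Real.rpow_natCast] at h
  exact h

theorem hybridDepth_pos (hs : 2 ≤ s) (hε0 : 0 < ε) (hε : ε < 1 / 2) : 1 ≤ hybridDepth s ε := by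
  have hs' : (2 : ℝ) ≤ s := by exact_mod_cast hs
  by_contra! h
  have h1 := le_two_pow_hybridDepth hs hε0
  rw [Nat.lt_one_iff.1 h, pow_zero, div_le_iff₀ hε0] at h1
  linarith

/-- The depth is at most 11 + log s + log(1/ε), and log s ≥ 1 and log X ≥ 2 absorb the constant. -/
theorem hybridDepth_le (hs : 2 ≤ s) (hε0 : 0 < ε) (hε : ε < 1 / 2) :
    (hybridDepth s ε : ℝ) ≤
      7 * (Real.logb 2 s * Real.logb 2 (Real.logb 2 s ^ 2 / ε ^ 2)) := by
  have hs' : (2 : ℝ) ≤ s := by exact_mod_cast hs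
  have hl := one_le_logb_cast hs
  have ha := one_le_logb_inv hε0 hε
  have hx := two_mul_logb_inv_le hs hε0
  have e : Real.logb 2 (1000 * s / ε) = Real.logb 2 1000 + Real.logb 2 s + Real.logb 2 (1 / ε) := by
    rw [← Real.logb_mul (by norm_num) (by positivity), ← Real.logb_mul (by positivity) (by positivity)]
    congr 1
    ring
  have h1000 : Real.logb 2 1000 ≤ 10 := by
    rw [Real.logb_le_iff_le_rpow one_lt_two (by norm_num)]
    norm_num
  have h0 : 0 ≤ Real.logb 2 (1000 * s / ε) := by
    refine Real.logb_nonneg one_lt_two ?_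
    rw [le_div_iff₀ hε0]
    linarith
  have h := (Nat.ceil_lt_add_one h0).le
  rw [hybridDepth]
  set X' := Real.logb 2 (Real.logb 2 s ^ 2 / ε ^ 2)
  set l := Real.logb 2 s
  nlinarith [mul_nonneg (sub_nonneg.2 hl) (by linarith : 0 ≤ X' - 2)]

theorem exp_lt_sizeParameter (s : ℕ) (ε : ℝ) :
    Real.exp (1000 * hybridDepth s ε * (Real.logb 2 s ^ 2 / ε ^ 2)) < sizeParameter s ε := by
  rw [sizeParameter]
  push_cast
  exact Nat.lt_floor_add_one _

theorem softBound_one (K : ℝ) (s : ℕ) (ε : ℝ) :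
    softBound K 1 s ε =
      K * ((Real.logb 2 s ^ 2 / ε ^ 2) * Real.logb 2 (Real.logb 2 s ^ 2 / ε ^ 2)) := by
  rw [softBound, pow_one, mul_assoc]

theorem one_le_softBound_unit (hs : 2 ≤ s) (hε0 : 0 < ε) (hε : ε < 1 / 2) :
    1 ≤ (Real.logb 2 s ^ 2 / ε ^ 2) * Real.logb 2 (Real.logb 2 s ^ 2 / ε ^ 2) := by
  have h1 := one_le_ratio hs hε0 hε
  have h2 := two_mul_logb_inv_le hs hε0
  have h3 := one_le_logb_inv hε0 hε
  rw [← div_pow] at *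
  exact one_le_mul_of_one_le_of_one_le (one_le_pow₀ h1) (by linarith)

theorem sizeParameter_le (hs : 2 ≤ s) (hε0 : 0 < ε) (hε : ε < 1 / 2) :
    (sizeParameter s ε : ℝ) ≤ (s : ℝ) ^ softBound 20000 1 s ε := by
  have hs' : (2 : ℝ) ≤ s := by exact_mod_cast hs
  have hl := one_le_logb_cast hs
  have hD := hybridDepth_le hs hε0 hε
  have hu := one_le_softBound_unit hs hε0 hε
  rw [softBound_one]
  have hX : 0 ≤ Real.logb 2 s ^ 2 / ε ^ 2 := by positivity
  set X := Real.logb 2 s ^ 2 / ε ^ 2 with hXdef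
  set X' := Real.logb 2 X
  set l := Real.logb 2 s with hldef
  set D : ℝ := (hybridDepth s ε : ℝ) with hDdef
  have hes : (s : ℝ) = 2 ^ l := (Real.rpow_logb two_pos (by norm_num) (by linarith)).symm
  have hexp : Real.exp (1000 * D * X) ≤ 2 ^ (2000 * D * X) := by
    have h4 : Real.exp 1 ≤ (2 : ℝ) ^ (2 : ℝ) := by
      have := Real.exp_one_lt_d9
      rw [Real.rpow_two]
      linarith
    calc Real.exp (1000 * D * X) = Real.exp 1 ^ (1000 * D * X) := (Real.exp_one_rpow _).symm
      _ ≤ ((2 : ℝ) ^ (2 : ℝ)) ^ (1000 * D * X) := by gcongr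
      _ = _ := by rw [← Real.rpow_mul zero_le_two]; ring_nf
  have hfl : (⌊Real.exp (1000 * D * X)⌋₊ : ℝ) ≤ Real.exp (1000 * D * X) :=
    Nat.floor_le (Real.exp_pos _).le
  have h1 : (1 : ℝ) ≤ 2 ^ (2000 * D * X) := Real.one_le_rpow one_le_two (by positivity)
  calc (sizeParameter s ε : ℝ) = (⌊Real.exp (1000 * D * X)⌋₊ : ℝ) + 1 := by
        rw [sizeParameter]
        push_cast
        rfl
    _ ≤ 2 * 2 ^ (2000 * D * X) := by linarith
    _ = 2 ^ (1 + 2000 * D * X) := by rw [Real.rpow_add two_pos, Real.rpow_one]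
    -- By `hybridDepth_le` the exponent is at most 1 + 14000·l·X·log X.
    _ ≤ 2 ^ (l * (20000 * (X * X'))) := by
        refine Real.rpow_le_rpow_of_exponent_le one_le_two ?_
        have h5 : D * X ≤ 7 * (l * X') * X := mul_le_mul_of_nonneg_right hD hX
        have h6 : 1 ≤ l * (X * X') := one_le_mul_of_one_le_of_one_le hl hu
        linarith
    _ = _ := by rw [hes, ← Real.rpow_mul zero_le_two]

theorem degree_le (hs : 2 ≤ s) (hε0 : 0 < ε) (hε : ε < 1 / 2) :
    Real.logb 2 (1 / ε) / (ε / Real.logb 2 s) ≤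
      (Real.logb 2 s ^ 2 / ε ^ 2) * Real.logb 2 (Real.logb 2 s ^ 2 / ε ^ 2) := by
  have hl := one_le_logb_cast hs
  have h1 := one_le_ratio hs hε0 hε
  have h2 := two_mul_logb_inv_le hs hε0
  have h3 := one_le_logb_inv hε0 hε
  rw [show Real.logb 2 (1 / ε) / (ε / Real.logb 2 s) =
    Real.logb 2 s / ε * Real.logb 2 (1 / ε) by field_simp]
  rw [← div_pow] at *
  exact mul_le_mul (le_self_pow₀ h1 two_ne_zero) (by linarith) (by linarith) (by positivity)

/-- The base dominates both the charge per coefficient and the remaining work, so the running time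
is one power of it. Since s ≥ 2, also n + 1 ≤ ns; the factors 4, t₀² and the power of n + 1 give
40004 = 2 + 2·20000 + 2. -/
theorem time_rate_le (hs : 2 ≤ s) (hε0 : 0 < ε) (hε : ε < 1 / 2) {n : ℕ} (hn : 1 ≤ n) (m : ℕ) :
    ((4 * sizeParameter s ε ^ 2 *
      (n + 1) ^ (⌊Real.logb 2 (1 / ε) / (ε / Real.logb 2 s)⌋₊ + 1) : ℕ) : ℝ) ^ m ≤
      ((n : ℝ) * s) ^ softBound (m * 40004) 1 s ε := by
  have hs' : (2 : ℝ) ≤ s := by exact_mod_cast hs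
  have hn' : (1 : ℝ) ≤ n := by exact_mod_cast hn
  have hl := one_le_logb_cast hs
  have hd := degree_le hs hε0 hε
  have hu := one_le_softBound_unit hs hε0 hε
  have hsz := sizeParameter_le hs hε0 hε
  have ha := one_le_logb_inv hε0 hε
  have hd0 : 0 ≤ Real.logb 2 (1 / ε) / (ε / Real.logb 2 s) := by positivity
  rw [softBound_one] at hsz ⊢
  set u := (Real.logb 2 s ^ 2 / ε ^ 2) * Real.logb 2 (Real.logb 2 s ^ 2 / ε ^ 2)
  set d := Real.logb 2 (1 / ε) / (ε / Real.logb 2 s)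
  set b := (n : ℝ) * s with hb
  have hb2 : 2 ≤ b := by nlinarith
  have hsb : (s : ℝ) ≤ b := by nlinarith
  have hnb : (n : ℝ) + 1 ≤ b := by nlinarith
  have h4 : (4 : ℝ) ≤ b ^ (2 * u) := by
    calc (4 : ℝ) ≤ b ^ (2 : ℝ) := by rw [Real.rpow_two]; nlinarith
      _ ≤ _ := Real.rpow_le_rpow_of_exponent_le (by linarith) (by linarith)
  have ht : (sizeParameter s ε : ℝ) ≤ b ^ (20000 * u) :=
    hsz.trans (Real.rpow_le_rpow (by linarith) hsb (by linarith))
  have hp : ((n : ℝ) + 1) ^ (⌊d⌋₊ + 1) ≤ b ^ (2 * u) := by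
    calc ((n : ℝ) + 1) ^ (⌊d⌋₊ + 1) ≤ b ^ (⌊d⌋₊ + 1) := by gcongr
      _ = b ^ (((⌊d⌋₊ + 1 : ℕ) : ℝ)) := (Real.rpow_natCast _ _).symm
      _ ≤ _ := by
        refine Real.rpow_le_rpow_of_exponent_le (by linarith) ?_
        have := Nat.floor_le hd0
        push_cast
        linarith
  push_cast
  calc _ ≤ (b ^ (2 * u) * (b ^ (20000 * u)) ^ 2 * b ^ (2 * u)) ^ m := by gcongr
    _ = (b ^ (40004 * u)) ^ m := by
        rw [← Real.rpow_two, ← Real.rpow_mul (by linarith), ← Real.rpow_add (by linarith),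
          ← Real.rpow_add (by linarith)]
        ring_nf
    _ = b ^ (m * 40004 * u) := by
        rw [← Real.rpow_natCast, ← Real.rpow_mul (by linarith)]
        ring_nf

end Parameters

/-- The running time, when all coefficients are cheap. -/
theorem time_le_rate {n : ℕ} [NeZero n] {s : ℕ} {ε : ℝ} (hs : 2 ≤ s) (hε0 : 0 < ε)
    (hε : ε < 1 / 2) {charge : ℕ → ℕ → ℕ} (f : Cube n → ℤˣ) (tie : TieBreak n) {δ d : ℝ}
    (hδ : δ = ε / Real.logb 2 s) (hd : Real.logb 2 (1 / ε) / δ = d) {t : ℕ} (ht : 1 ≤ t)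
    (ht0 : t ≤ sizeParameter s ε) (A : ℕ)
    (hB : ∀ j < t, ∀ p ∈ leaves (treeAfter f tie δ d j),
      charge ⌊d⌋₊ p.length ≤ (4 * sizeParameter s ε ^ 2 * (n + 1) ^ (⌊d⌋₊ + 1)) ^ A) :
    ((buildStabilizingDT charge f tie t δ ε).time : ℝ) ≤
      ((n : ℝ) * s) ^ softBound ((A + 3 : ℕ) * 40004) 1 s ε := by
  have hl := one_le_logb_cast hs
  have ha := one_le_logb_inv hε0 hε
  have hd0 : 0 ≤ d := by
    rw [← hd, hδ]
    positivity
  have h1 : 1 ≤ sizeParameter s ε := Nat.succ_pos _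
  have hY : 1 ≤ (n + 1) ^ (⌊d⌋₊ + 1) := Nat.one_le_pow _ _ n.succ_pos
  have hZ : 1 ≤ 4 * sizeParameter s ε ^ 2 * (n + 1) ^ (⌊d⌋₊ + 1) :=
    Nat.mul_pos (Nat.mul_pos (by norm_num) (Nat.pow_pos h1)) hY
  have h2 := time_buildStabilizingDT_le (charge := charge) f tie ht hd hd0
    (Nat.one_le_pow A _ hZ) hB
  have h3 : 17 * (t * (n + 1) ^ (⌊d⌋₊ + 1)) ^ 3 ≤
      (4 * sizeParameter s ε ^ 2 * (n + 1) ^ (⌊d⌋₊ + 1)) ^ 3 := by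
    have h4 : t ≤ sizeParameter s ε ^ 2 := ht0.trans (Nat.le_self_pow two_ne_zero _)
    calc _ ≤ 64 * (sizeParameter s ε ^ 2 * (n + 1) ^ (⌊d⌋₊ + 1)) ^ 3 := by gcongr; norm_num
      _ = _ := by ring
  have h5 := h2.trans (Nat.mul_le_mul_right _ h3)
  rw [← pow_add, add_comm 3 A] at h5
  refine (Nat.cast_le.2 h5).trans ?_
  rw [Nat.cast_pow, ← hd, hδ]
  exact time_rate_le hs hε0 hε (NeZero.one_le) (A + 3)

/-- The algorithm reaches a tree with small error and without deep leaves. -/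
theorem exists_good_round {n : ℕ} [NeZero n] {s : ℕ} {ε : ℝ} (hs : 2 ≤ s) (hε0 : 0 < ε)
    (hε : ε < 1 / 2) (f : Cube n → ℤˣ) (tie : TieBreak n) {δ d : ℝ}
    (hδ : δ = ε / Real.logb 2 s) (hd : Real.logb 2 (1 / ε) / δ = d) :
    ∃ k < sizeParameter s ε,
      (∀ charge, error f (complete charge f [] (treeAfter f tie δ d k)).val ≤
        73 * opt f s + ε) ∧
      ∀ j ≤ k, ∀ p ∈ leaves (treeAfter f tie δ d j), 2 ^ p.length ≤ 4 * sizeParameter s ε ^ 2 := by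
  have hl := one_le_logb_cast hs
  have ha := one_le_logb_inv hε0 hε
  have hD : (1 : ℝ) ≤ hybridDepth s ε := by exact_mod_cast hybridDepth_pos hs hε0 hε
  have hδ0 : 0 < δ := by rw [hδ]; positivity
  have hδ1 : δ ≤ 1 := by
    rw [hδ, div_le_one (by linarith)]
    linarith
  -- Chosen so that D·log s·κ = ε/1000, as `error_complete_le` requires; then 1/(δκ) is exactly the
  -- exponent 1000·D·X in `sizeParameter`.
  set κ := ε / 1000 / (hybridDepth s ε * Real.logb 2 s) with hκ
  have hκ0 : 0 < κ := by positivity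
  have hκ1 : κ ≤ 1 := by
    rw [hκ, div_le_one (by positivity)]
    nlinarith
  have hexp : Real.exp (1 / (δ * κ)) < sizeParameter s ε := by
    convert exp_lt_sizeParameter s ε using 2
    rw [hκ, hδ]
    field_simp
  obtain ⟨k, hk, h1, h2⟩ := exists_averageMaxInfluence_le (d := d) f tie hδ0 hδ1 hκ0 hexp
  refine ⟨k, hk, fun charge => ?_, fun j hj p hp => ?_⟩
  · refine error_complete_le (d := d) charge f
      (fun p hp => (leaves_treeAfter f tie hδ0.le hδ1 hκ0 hκ1 h2 p hp).1) hs hε0 hε hδ hδ1 ?_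
      (le_two_pow_hybridDepth hs hε0) ?_
    · rw [← hd, mul_div_cancel₀ _ hδ0.ne']
      exact ha
    · rw [hκ, le_div_iff₀ (by positivity)] at h1
      linarith
  · have h3 := (leaves_treeAfter f tie hδ0.le hδ1 hκ0 hκ1
      (fun i hi => h2 i (hi.trans_le hj)) p hp).2
    set t : ℝ := (sizeParameter s ε : ℝ) with ht
    have h4 : 1 / κ ≤ t := by
      calc 1 / κ ≤ 1 / (δ * κ) :=
            one_div_le_one_div_of_le (mul_pos hδ0 hκ0) (mul_le_of_le_one_left hκ0.le hδ1)
        _ ≤ 1 / (δ * κ) + 1 := by linarith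
        _ ≤ Real.exp (1 / (δ * κ)) := Real.add_one_le_exp _
        _ ≤ t := hexp.le
    have h5 : (j : ℝ) + 1 ≤ t := by
      rw [ht]
      exact_mod_cast hj.trans_lt hk
    -- The depth bound 2(j + 1)/κ is polynomial in t because t > exp(1/(δκ)) also exceeds 1/κ.
    have h6 : (2 : ℝ) ^ p.length ≤ 2 * t * t := by
      calc (2 : ℝ) ^ p.length ≤ 2 * (j + 1) / κ := by
            rw [le_div_iff₀ hκ0]
            linarith
        _ = 2 * (j + 1) * (1 / κ) := by ring
        _ ≤ 2 * t * t := by gcongr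
    have h7 : (2 : ℝ) ^ p.length ≤ 4 * t ^ 2 := by nlinarith [sq_nonneg t]
    rw [ht] at h7
    exact_mod_cast h7

end StabDT

end

theorem theorem1 :
    ∃ (C K : ℝ) (K' : ℕ → ℝ) (c : ℕ) (t₀ : ℕ → ℝ → ℕ),
      ∀ (s : ℕ) (ε : ℝ), 2 ≤ s → 0 < ε → ε < 1 / 2 →
        (1 ≤ t₀ s ε ∧ (t₀ s ε : ℝ) ≤ (s : ℝ) ^ StabDT.softBound K c s ε) ∧
        ∀ (n : ℕ) (f : StabDT.Cube n → ℤˣ) (tie : StabDT.TieBreak n) (δ : ℝ),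
          1 ≤ n → δ = ε / Real.logb 2 s →
          -- the size parameter `t₀ s ε`, which depends on `s` and `ε` only
          (∀ A : ℕ,
            (StabDT.buildStabilizingDT (StabDT.queryCharge A n) f tie (t₀ s ε) δ ε).val.size
                = t₀ s ε ∧
            StabDT.error f
                (StabDT.buildStabilizingDT (StabDT.queryCharge A n) f tie (t₀ s ε) δ ε).val
              ≤ C * StabDT.opt f s + ε ∧
            ((StabDT.buildStabilizingDT (StabDT.queryCharge A n) f tie (t₀ s ε) δ ε).time : ℝ)
              ≤ ((n : ℝ) * s) ^ StabDT.softBound (K' A) c s ε) ∧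
          -- a size parameter for which leaves of depth `k` may be charged `poly (2 ^ k)`
          (∃ t : ℕ, 1 ≤ t ∧ t ≤ t₀ s ε ∧ ∀ A : ℕ,
            (StabDT.buildStabilizingDT (StabDT.exampleCharge A n) f tie t δ ε).val.size = t ∧
            StabDT.error f
                (StabDT.buildStabilizingDT (StabDT.exampleCharge A n) f tie t δ ε).val
              ≤ C * StabDT.opt f s + ε ∧
            ((StabDT.buildStabilizingDT (StabDT.exampleCharge A n) f tie t δ ε).time : ℝ)
              ≤ ((n : ℝ) * s) ^ StabDT.softBound (K' A) c s ε) := by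
  -- The exponent A + 3 combines the charge, a power A of the common base, with its cube for the
  -- remaining work.
  refine ⟨73, 20000, fun A => ((A + 3 : ℕ) : ℝ) * 40004, 1, StabDT.sizeParameter, ?_⟩
  intro s ε hs hε0 hε
  refine ⟨⟨Nat.succ_pos _, StabDT.sizeParameter_le hs hε0 hε⟩, fun n f tie δ hn hδ => ?_⟩
  have : NeZero n := ⟨by omega⟩
  obtain ⟨k, hk, herr, hdepth⟩ := StabDT.exists_good_round hs hε0 hε f tie hδ rfl
  have ht0 : 1 ≤ StabDT.sizeParameter s ε := Nat.succ_pos _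
  refine ⟨fun A => ⟨?_, ?_, ?_⟩, k + 1, Nat.succ_pos k, hk, fun A => ⟨?_, ?_, ?_⟩⟩
  · rw [StabDT.val_buildStabilizingDT, StabDT.size_complete, StabDT.size_treeAfter]
    omega
  · rw [StabDT.val_buildStabilizingDT]
    -- The good round precedes round t₀ - 1, and further splits do not increase the error.
    exact (StabDT.error_treeAfter_antitone _ f tie _ _ (Nat.le_sub_one_of_lt hk)).trans (herr _)
  · refine StabDT.time_le_rate hs hε0 hε f tie hδ rfl ht0 le_rfl A fun j hj p hp => ?_
    refine Nat.pow_le_pow_left (Nat.mul_le_mul_right _ ?_) A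
    -- Beyond the good round there is no logarithmic depth bound, but the query charge only needs
    -- depth + 1 ≤ size ≤ t₀.
    have h1 := StabDT.length_lt_size hp
    rw [StabDT.size_treeAfter] at h1
    nlinarith
  · rw [StabDT.val_buildStabilizingDT, StabDT.size_complete, StabDT.size_treeAfter]
    omega
  · rw [StabDT.val_buildStabilizingDT]
    exact herr _
  · refine StabDT.time_le_rate hs hε0 hε f tie hδ rfl (Nat.succ_pos k) hk A fun j hj p hp => ?_
    exact Nat.pow_le_pow_left (Nat.mul_le_mul_right _ (hdepth j (Nat.lt_succ_iff.1 hj) p hp)) A
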